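/- \textbf{Setting.} Let $X$ (states) and $U$ (actions) be measurable spaces with countably generated $\sigma$-algebras (e.g. standard Borel spaces), $T\in\mathbb N$ a horizon, $p_0$ a probability measure on $X$, $c_t:X\times U\to[0,\infty)$ ($t<T$) and $c_T:X\to[0,\infty)$ measurable costs, $\rho_t(du\mid x)$ reference policies and $\iota_t(dx'\mid x,u)$ system transition kernels (Markov kernels, $t<T$), $\lambda^P>0$ and $\lambda^S\in\mathbb R\setminus\{0\}$. A policy sequence $\pi=(\pi_t)_{t<T}$ and a sequence of transition kernels $\tau=(\tau_t)_{t<T}$ are sequences of Markov kernels $\pi_t(du\mid x)$, $\tau_t(dx'\mid x,u)$. Let $\mathbb D(\nu\|\mu)\in[0,\infty]$ be the Kullback--Leibler divergence ($+\infty$ if $\nu\not\ll\mu$), and $\mathcal R^\lambda_\mu[f]=-\frac1\lambda\log\mathbb E_\mu[e^{-\lambda f}]$ the entropic risk operator. Write $\operatorname{opt}^{\lambda}$ for the infimum if $\lambda>0$ and for the supremum if $\lambda<0$. For $0\le t\le T$ and a law $\mu$ of $x_t$, put $$J_t(\mu;\pi,\tau)=\mathbb E\Big[\sum_{k=t}^{T-1}c_k(x_k,u_k)+c_T(x_T)\Big]+\frac1{\lambda^P}\mathbb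 E\Big[\sum_{k=t}^{T-1}\mathbb D\big(\pi_k(\cdot|x_k)\|\rho_k(\cdot|x_k)\big)\Big]+\frac1{\lambda^S}K_t(\mu;\pi,\tau),$$ $$K_t(\mu;\pi,\tau)=\mathbb E\Big[\sum_{k=t}^{T-1}\mathbb D\big(\tau_k(\cdot|x_k,u_k)\|\iota_k(\cdot|x_k,u_k)\big)\Big],$$ where the expectation is over trajectories $(x_t,u_t,\dots,x_T)$ with $x_t\sim\mu$, $u_k\sim\pi_k(\cdot|x_k)$, $x_{k+1}\sim\tau_k(\cdot|x_k,u_k)$. Values are in $[-\infty,\infty]$ with $\infty-\infty:=-\infty$ (so for $\lambda^S<0$ only kernels with finite penalty matter in the maximization); the same convention is used for the one-stage functionals below. The central KL-regularized control problem is $\inf_\pi\operatorname{opt}^{\lambda^S}_\tau J_0(p_0;\pi,\tau)$. \textbf{Recursion.} Define $V_T=c_T$ and, for $t=T-1,\dots,0$, $$Q_t(x,u)=\mathcal R^{\lambda^S}_{\iota_t(\cdot|x,u)}[c_t(x,u)+V_{t+1}],\qquad V_t(x)=\mathcal R^{\lambda^P}_{\rho_t(\cdot|x)}[Q_t(x,\cdot)],$$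 $$\pi^*_t(du|x)=\rho_t(du|x)\,\frac{e^{-\lambda^PQ_t(x,u)}}{e^{-\lambda^PV_t(x)}},\qquad \tau^*_t(dx'|x,u)=\iota_t(dx'|x,u)\,\frac{e^{-\lambda^S(c_t(x,u)+V_{t+1}(x'))}}{e^{-\lambda^SQ_t(x,u)}}.$$ If $\lambda^S<0$, assume $\mathbb E_{\iota_t(\cdot|x,u)}[e^{-\lambda^S(c_t(x,u)+V_{t+1})}]<\infty$ for all $t<T$ and all $(x,u)$. \textbf{Theorem.} The functions $V_t,Q_t$ are measurable, real-valued and nonnegative, and $\pi^*_t,\tau^*_t$ are Markov kernels. Moreover: \begin{enumerate} \item For all $t<T$ and $x$, $V_t(x)=\min_{\nu}\{\mathbb E_\nu[Q_t(x,\cdot)]+\frac1{\lambda^P}\mathbb D(\nu\|\rho_t(\cdot|x))\}$ over probability measures $\nu$ on $U$, and $\pi^*_t(\cdot|x)$ is the unique minimizer. \item For all $t<T$ and $(x,u)$, $Q_t(x,u)=\operatorname{opt}^{\lambda^S}_{\nu}\{\mathbb E_\nu[c_t(x,u)+V_{t+1}]+\frac1{\lambda^S}\mathbb D(\nu\|\iota_t(\cdot|x,u))\}$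 over probability measures $\nu$ on $X$; no $\nu\ne\tau^*_t(\cdot|x,u)$ attains this value. If $\lambda^S>0$, or if $\mathbb D(\tau^*_t(\cdot|x,u)\|\iota_t(\cdot|x,u))<\infty$, then $\tau^*_t(\cdot|x,u)$ attains it, and $\tau^*_t(\cdot|x,u)$ is also the unique minimizer ($\lambda^S>0$) or maximizer ($\lambda^S<0$) of $\nu\mapsto\mathbb E_\nu[V_{t+1}]+\frac1{\lambda^S}\mathbb D(\nu\|\iota_t(\cdot|x,u))$. \item For all $t\le T$ and $x$, $V_t$ is the optimal cost-to-go: $V_t(x)=\inf_\pi\operatorname{opt}^{\lambda^S}_\tau J_t(\delta_x;\pi,\tau)$. The infimum is attained at $\pi^*$: $\operatorname{opt}^{\lambda^S}_\tau J_t(\delta_x;\pi^*,\tau)=V_t(x)$. If $\lambda^S>0$, or if $K_t(\delta_x;\pi^*,\tau^*)<\infty$, then $\tau^*$ attains the inner optimum: $J_t(\delta_x;\pi^*,\tau^*)=V_t(x)$. \item The central problem has optimal value $\mathbb E_{p_0}[V_0]\in[0,\infty]$, with outer infimum attained at $\pi^*$; if $\lambda^S>0$, or if $K_0(p_0;\pi^*,\tau^*)<\infty$,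 the inner optimum for $\pi^*$ is attained at $\tau^*$: $J_0(p_0;\pi^*,\tau^*)=\mathbb E_{p_0}[V_0]$. \end{enumerate} -/

import Mathlib

open MeasureTheory ProbabilityTheory InformationTheory
open scoped ENNReal

noncomputable section

/-- The entropic risk operator `R^λ_μ[f] = -(1/λ) log E_μ[exp(-λ f)]`. -/
def entropicRisk {α : Type*} [MeasurableSpace α] (lam : ℝ) (μ : Measure α) (f : α → ℝ) : ℝ :=
  -(1 / lam) * Real.log (∫ a, Real.exp (-lam * f a) ∂μ)

/-- The extremal value over a set of decisions: infimum if `λ > 0`, supremum otherwise. -/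
def optOver {α : Type*} (lam : ℝ) (S : Set α) (J : α → EReal) : EReal :=
  if 0 < lam then ⨅ q ∈ S, J q else ⨆ q ∈ S, J q

/-- `q` is a minimizer of `J` over `S` if `λ > 0`, and a maximizer otherwise. -/
def IsArgOpt {α : Type*} (lam : ℝ) (S : Set α) (J : α → EReal) (q : α) : Prop :=
  q ∈ S ∧ ∀ q' ∈ S, if 0 < lam then J q ≤ J q' else J q' ≤ J q

/-- The set of probability measures on `α`. -/
def probMeasures (α : Type*) [MeasurableSpace α] : Set (Measure α) :=
  {ν | IsProbabilityMeasure ν}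

/-- The one-stage functional `E_ν[f] + (1/λ) D(ν ‖ μ)` of a probability measure `ν`, for a
nonnegative measurable `f`, with values in the extended reals. Since `⊤ + ⊥ = ⊥`, for `λ < 0` it is
`-∞` whenever the divergence is infinite (in particular if `ν` is not absolutely continuous with
respect to `μ`), and for `λ > 0` it is `+∞` then. -/
def klStage {α : Type*} [MeasurableSpace α] (lam : ℝ) (μ : Measure α) (f : α → ℝ)
    (ν : Measure α) : EReal :=
  ((∫⁻ a, ENNReal.ofReal (f a) ∂ν : ℝ≥0∞) : EReal)
    + ((1 / lam : ℝ) : EReal) * ((klDiv ν μ : ℝ≥0∞) : EReal)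

/-- Trajectories `(x_0, u_0, …, u_{n-1}, x_n)` with `n` steps. -/
abbrev Trajectory (X U : Type*) (n : ℕ) : Type _ := (Fin (n + 1) → X) × (Fin n → U)

/-- Prepend a state and an action to a trajectory. -/
def Trajectory.cons {X U : Type*} {n : ℕ} (p : X × U × Trajectory X U n) :
    Trajectory X U (n + 1) :=
  (Fin.cons p.1 p.2.2.1, Fin.cons p.2.1 p.2.2.2)

theorem Trajectory.measurable_cons {X U : Type*} [MeasurableSpace X] [MeasurableSpace U] {n : ℕ} :
    Measurable (Trajectory.cons : X × U × Trajectory X U n → Trajectory X U (n + 1)) := by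
  refine Measurable.prodMk ?_ ?_
  · refine measurable_pi_lambda _ fun i => ?_
    refine Fin.cases ?_ (fun j => ?_) i
    · simpa [Trajectory.cons] using measurable_fst
    · simp only [Fin.cons_succ]
      fun_prop
  · refine measurable_pi_lambda _ fun i => ?_
    refine Fin.cases ?_ (fun j => ?_) i
    · simp only [Fin.cons_zero]
      fun_prop
    · simp only [Fin.cons_succ]
      fun_prop

/-- The conditional law, given the state at time `t`, of the trajectory of the next `n` steps when
at each time `k` the action is drawn from `π k` and the next state from `τ k`. -/
def trajKernel {X U : Type*} [MeasurableSpace X] [MeasurableSpace U]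
    (π : ℕ → Kernel X U) (τ : ℕ → Kernel (X × U) X) :
    (n : ℕ) → (t : ℕ) → Kernel X (Trajectory X U n)
  | 0, _ => Kernel.deterministic (fun x => (fun _ => x, Fin.elim0)) (by fun_prop)
  | n + 1, t =>
    (Kernel.id ×ₖ (π t ⊗ₖ (trajKernel π τ n (t + 1) ∘ₖ τ t))).map Trajectory.cons

/-- The data of the central KL-regularized control problem: horizon, law of the initial state,
nonnegative running and terminal costs, reference policies `ρ`, system transition kernels `ι`, and
the two regularization weights. Sequences are indexed by `ℕ`; only times `t < T` are used. -/
structure KLControl (X U : Type*) [MeasurableSpace X] [MeasurableSpace U] where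
  T : ℕ
  init : Measure X
  init_prob : IsProbabilityMeasure init
  c : ℕ → X × U → ℝ
  c_measurable : ∀ t, Measurable (c t)
  c_nonneg : ∀ t z, 0 ≤ c t z
  cT : X → ℝ
  cT_measurable : Measurable cT
  cT_nonneg : ∀ x, 0 ≤ cT x
  ρ : ℕ → Kernel X U
  ρ_markov : ∀ t, IsMarkovKernel (ρ t)
  ι : ℕ → Kernel (X × U) X
  ι_markov : ∀ t, IsMarkovKernel (ι t)
  lamP : ℝ
  lamP_pos : 0 < lamP
  lamS : ℝ
  lamS_ne_zero : lamS ≠ 0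

namespace KLControl

attribute [instance] KLControl.init_prob KLControl.ρ_markov KLControl.ι_markov

variable {X U : Type*} [MeasurableSpace X] [MeasurableSpace U] (P : KLControl X U)

/-- Admissible policy sequences. -/
def policies : Set (ℕ → Kernel X U) := {π | ∀ t < P.T, IsMarkovKernel (π t)}

/-- Admissible sequences of transition kernels. -/
def transitions : Set (ℕ → Kernel (X × U) X) := {τ | ∀ t < P.T, IsMarkovKernel (τ t)}

/-- The law of the trajectory from time `t` to the horizon when the state at time `t` has
law `μ`. -/
def law (π : ℕ → Kernel X U) (τ : ℕ → Kernel (X × U) X) (t : ℕ) (μ : Measure X) :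
    Measure (Trajectory X U (P.T - t)) :=
  μ.bind (trajKernel π τ (P.T - t) t)

/-- Cumulative cost of a trajectory that starts at time `t`. -/
def cumCost (t : ℕ) (ξ : Trajectory X U (P.T - t)) : ℝ≥0∞ :=
  (∑ k : Fin (P.T - t), ENNReal.ofReal (P.c (t + k) (ξ.1 k.castSucc, ξ.2 k)))
    + ENNReal.ofReal (P.cT (ξ.1 (Fin.last _)))

/-- `∑ₖ D(π_k(·|x_k) ‖ ρ_k(·|x_k))` along a trajectory that starts at time `t`. -/
def policyKL (π : ℕ → Kernel X U) (t : ℕ) (ξ : Trajectory X U (P.T - t)) : ℝ≥0∞ :=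
  ∑ k : Fin (P.T - t), klDiv (π (t + k) (ξ.1 k.castSucc)) (P.ρ (t + k) (ξ.1 k.castSucc))

/-- `∑ₖ D(τ_k(·|x_k,u_k) ‖ ι_k(·|x_k,u_k))` along a trajectory that starts at time `t`. -/
def transitionKL (τ : ℕ → Kernel (X × U) X) (t : ℕ) (ξ : Trajectory X U (P.T - t)) : ℝ≥0∞ :=
  ∑ k : Fin (P.T - t),
    klDiv (τ (t + k) (ξ.1 k.castSucc, ξ.2 k)) (P.ι (t + k) (ξ.1 k.castSucc, ξ.2 k))

/-- The expected transition penalty (not yet multiplied by `1/λ^S`). -/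
def expTransitionKL (t : ℕ) (μ : Measure X) (π : ℕ → Kernel X U) (τ : ℕ → Kernel (X × U) X) :
    ℝ≥0∞ :=
  ∫⁻ ξ, P.transitionKL τ t ξ ∂(P.law π τ t μ)

/-- The objective from time `t` on, with law `μ` of the state at time `t`: expected cumulative cost
plus `(1/λ^P)` times the policy penalty plus `(1/λ^S)` times the transition penalty. Since
`⊤ + ⊥ = ⊥`, for `λ^S < 0` the objective is `-∞` when the expected transition penalty is infinite,
so the maximization over `τ` is effectively over those with finite penalty. -/
def objective (t : ℕ) (μ : Measure X) (π : ℕ → Kernel X U) (τ : ℕ → Kernel (X × U) X) : EReal :=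
  ((∫⁻ ξ, P.cumCost t ξ ∂(P.law π τ t μ) : ℝ≥0∞) : EReal)
    + ((1 / P.lamP : ℝ) : EReal) * ((∫⁻ ξ, P.policyKL π t ξ ∂(P.law π τ t μ) : ℝ≥0∞) : EReal)
    + ((1 / P.lamS : ℝ) : EReal) * ((P.expTransitionKL t μ π τ : ℝ≥0∞) : EReal)

/-- The inner problem: `opt^{λ^S}` over transition kernels, for a given policy sequence. -/
def innerValue (t : ℕ) (μ : Measure X) (π : ℕ → Kernel X U) : EReal :=
  optOver P.lamS P.transitions (fun τ => P.objective t μ π τ)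

/-- The optimal value `min_π opt^{λ^S}_τ` of the problem from time `t` on. -/
def optimalValue (t : ℕ) (μ : Measure X) : EReal :=
  ⨅ π ∈ P.policies, P.innerValue t μ π

/-- The backward recursion, by the number of remaining steps. -/
def valueAux : ℕ → ℕ → X → ℝ
  | 0, _, x => P.cT x
  | n + 1, t, x =>
    entropicRisk P.lamP (P.ρ t x) fun u =>
      entropicRisk P.lamS (P.ι t (x, u)) fun x' => P.c t (x, u) + valueAux n (t + 1) x'

/-- The function `V_t` of the backward recursion, for `t ≤ T`. -/
def V (t : ℕ) (x : X) : ℝ := P.valueAux (P.T - t) t x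

/-- The function `Q_t` of the backward recursion, for `t < T`. -/
def Q (t : ℕ) (z : X × U) : ℝ :=
  entropicRisk P.lamS (P.ι t z) fun x' => P.c t z + P.V (t + 1) x'

/-- The tilted policies `π*_t = ρ_t exp(-λ^P Q_t) / exp(-λ^P V_t)`. -/
def optPolicy (t : ℕ) : Kernel X U :=
  (P.ρ t).withDensity fun x u =>
    ENNReal.ofReal (Real.exp (-P.lamP * P.Q t (x, u)) / Real.exp (-P.lamP * P.V t x))

/-- The tilted kernels `τ*_t = ι_t exp(-λ^S (c_t + V_{t+1})) / exp(-λ^S Q_t)`. -/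
def optTransition (t : ℕ) : Kernel (X × U) X :=
  (P.ι t).withDensity fun z x' =>
    ENNReal.ofReal
      (Real.exp (-P.lamS * (P.c t z + P.V (t + 1) x')) / Real.exp (-P.lamS * P.Q t z))

end KLControl

end

/-! The engine is the Gibbs variational identity. Let `R` be the entropic risk of `f ≥ 0` under `μ`,
and let `μ'` be `μ` tilted by `exp(-λ f)`. Then `E_ν[f] + (1/λ) D(ν‖μ) = R + (1/λ) D(ν‖μ')` for `λ >
0`, and `E_ν[f] + |1/λ| D(ν‖μ') = R + |1/λ| D(ν‖μ)` for `λ < 0` (`lintegral_add_klDiv_eq_of_pos`,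
`lintegral_add_klDiv_eq_of_neg`). Each term stands on the side where its coefficient is nonnegative,
so these are equalities in `[0,∞]` that hold with infinite terms too. The leftover `D(ν‖μ')` is
nonnegative and vanishes only at `ν = μ'`; this yields the one-stage bounds and uniqueness.

Along trajectories, cost and penalties form an additive functional, and a backward induction
compares it with sub- and supersolutions (`le_lintegral_runningSum`, `lintegral_runningSum_le`). The
one-stage identities make the value functions a subsolution or a supersolution, as needed. The upper
bound uses `π*`, against every `τ` if `λ^S < 0` and against `τ*` if `λ^S > 0`. The lower bound for
arbitrary `π` holds against every `τ` if `λ^S > 0`.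

For the lower bound with `λ^S < 0`, `τ*` may have infinite penalty, which makes its objective `-∞`.
Instead the continuation cost is cut at level `m` at every stage of the recursion. The resulting
tilted kernels have bounded stage penalties and guarantee the truncated value against every policy.
The truncated values converge to `V` (`VRec_truncAt_le_and_tendsto`), and Fatou's lemma passes to
the limit in `le_innerValue`. Since these kernels do not depend on `π`, neither a minimax theorem
nor a measurable selection is needed. -/

noncomputable section

/-! ### Gibbs variational identities and the entropic risk -/

section GibbsVariational

variable {α : Type*} [MeasurableSpace α]

/-- The negative part of a log-likelihood ratio is always integrable. -/
theorem integrable_min_llr_zero {μ ν : Measure α} [IsFiniteMeasure μ] [IsFiniteMeasure ν]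
    (hνμ : ν ≪ μ) : Integrable (fun a => min (llr ν μ a) 0) ν := by
  rw [← integrable_rnDeriv_smul_iff hνμ]
  refine Integrable.of_bound (C := 1) ?_ (Filter.Eventually.of_forall fun a => ?_)
  · have := measurable_llr ν μ
    exact Measurable.aestronglyMeasurable (by fun_prop)
  · set r := (ν.rnDeriv μ a).toReal with hr
    have hr0 : 0 ≤ r := ENNReal.toReal_nonneg
    have hl : llr ν μ a = Real.log r := rfl
    rw [hl, smul_eq_mul, Real.norm_eq_abs, abs_le]
    constructor
    · rcases le_total (Real.log r) 0 with h | h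
      · rw [min_eq_left h]
        have := klFun_nonneg hr0
        unfold klFun at this
        linarith
      · simp [min_eq_right h]
    · have : r * min (Real.log r) 0 ≤ 0 := mul_nonpos_of_nonneg_of_nonpos hr0 (min_le_right _ _)
      linarith

theorem integrable_exp_neg {μ : Measure α} [IsFiniteMeasure μ] {g : α → ℝ} (hg : Measurable g)
    (hg0 : ∀ a, 0 ≤ g a) : Integrable (fun a => Real.exp (-g a)) μ := by
  refine Integrable.of_bound (C := 1) (Measurable.aestronglyMeasurable (by fun_prop))
    (Filter.Eventually.of_forall fun a => ?_)
  rw [Real.norm_eq_abs, abs_of_pos (Real.exp_pos _), Real.exp_le_one_iff]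
  linarith [hg0 a]

theorem integral_exp_neg_le_one {μ : Measure α} [IsProbabilityMeasure μ] {g : α → ℝ}
    (hg0 : ∀ a, 0 ≤ g a) : ∫ a, Real.exp (-g a) ∂μ ≤ 1 := by
  by_cases hi : Integrable (fun a => Real.exp (-g a)) μ
  · calc ∫ a, Real.exp (-g a) ∂μ ≤ ∫ _, (1 : ℝ) ∂μ :=
          integral_mono hi (integrable_const _) fun a => by
            simpa using hg0 a
      _ = 1 := by simp
  · simp [integral_undef hi]

theorem klDiv_eq_ofReal_integral_llr {μ ν : Measure α} [IsProbabilityMeasure μ]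
    [IsProbabilityMeasure ν] (h1 : ν ≪ μ) (h2 : Integrable (llr ν μ) ν) :
    klDiv ν μ = ENNReal.ofReal (∫ a, llr ν μ a ∂ν) := by
  simp [klDiv_of_ac_of_integrable h1 h2]

theorem integral_llr_nonneg {μ ν : Measure α} [IsProbabilityMeasure μ]
    [IsProbabilityMeasure ν] (h1 : ν ≪ μ) (h2 : Integrable (llr ν μ) ν) :
    0 ≤ ∫ a, llr ν μ a ∂ν := by
  simpa using integral_llr_add_sub_measure_univ_nonneg h1 h2

/-- Gibbs variational identity for an exponential tilt by a nonpositive function. -/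
theorem klDiv_tilted_neg_add {μ ν : Measure α} [IsProbabilityMeasure μ] [IsProbabilityMeasure ν]
    {g : α → ℝ} (hg : Measurable g) (hg0 : ∀ a, 0 ≤ g a) :
    klDiv ν (μ.tilted fun a => -g a) + ENNReal.ofReal (-Real.log (∫ a, Real.exp (-g a) ∂μ))
      = klDiv ν μ + ∫⁻ a, ENNReal.ofReal (g a) ∂ν := by
  have hi := integrable_exp_neg (μ := μ) hg hg0
  have hprob := isProbabilityMeasure_tilted hi
  have hZ : 0 ≤ -Real.log (∫ a, Real.exp (-g a) ∂μ) := by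
    have := Real.log_nonpos (integral_exp_pos hi).le (integral_exp_neg_le_one (μ := μ) hg0)
    linarith
  by_cases hac : ν ≪ μ
  swap
  -- The tilt is absolutely continuous with respect to `μ`, so both divergences are infinite here.
  · rw [klDiv_of_not_ac hac, klDiv_of_not_ac fun h =>
      hac (h.trans (tilted_absolutelyContinuous _ _))]
    simp
  have hac' : ν ≪ μ.tilted fun a => -g a := hac.trans (absolutelyContinuous_tilted hi)
  have hllr := llr_tilted_right hac hi
  -- If both are integrable, this is an identity between real integrals; otherwise both sides are
  -- shown to be `⊤`.
  by_cases hgi : Integrable (llr ν μ) ν ∧ Integrable g ν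
  · obtain ⟨h1, h2⟩ := hgi
    have h3 := integrable_llr_tilted_right hac h2.neg h1 hi
    have h4 := integral_llr_tilted_right hac h2.neg hi h1
    have h5 := integral_llr_nonneg hac' h3
    rw [klDiv_eq_ofReal_integral_llr hac' h3, klDiv_eq_ofReal_integral_llr hac h1,
      ← ofReal_integral_eq_lintegral_ofReal h2 (Filter.Eventually.of_forall hg0),
      ← ENNReal.ofReal_add h5 hZ,
      ← ENNReal.ofReal_add (integral_llr_nonneg hac h1) (integral_nonneg hg0)]
    congr 1
    have h6 : ∫ a, (-g) a ∂ν = -∫ a, g a ∂ν := integral_neg _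
    have h4' : ∫ x, llr ν (μ.tilted fun a => -g a) x ∂ν
      = ∫ x, llr ν μ x ∂ν - ∫ x, (-g) x ∂ν + Real.log (∫ x, Real.exp (-g x) ∂μ) := h4
    rw [h4', h6]
    ring
  · have hL : klDiv ν (μ.tilted fun a => -g a) = ⊤ := by
      refine klDiv_of_not_integrable fun h => hgi ?_
      rw [integrable_congr hllr] at h
      have hsum : Integrable (fun a => g a + llr ν μ a) ν := by
        have := h.sub (integrable_const (Real.log (∫ z, Real.exp (-g z) ∂μ)))
        refine this.congr (Filter.Eventually.of_forall fun a => ?_)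
        simp only [Pi.sub_apply]
        ring
      -- Integrability of `g + llr` alone might hide a cancellation. As `g ≥ 0`, the positive part
      -- of `llr` is at most `|g + llr|`, and the negative part is always integrable, so `llr` and
      -- `g` are integrable separately.
      have hneg := integrable_min_llr_zero hac
      have hl : Integrable (llr ν μ) ν := by
        refine (hsum.norm.add hneg.norm).mono (measurable_llr ν μ).aestronglyMeasurable
          (Filter.Eventually.of_forall fun a => ?_)
        simp only [Pi.add_apply, Real.norm_eq_abs]
        rw [abs_of_nonneg (by positivity : 0 ≤ |g a + llr ν μ a| + |min (llr ν μ a) 0|)]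
        have := hg0 a
        rcases le_total (llr ν μ a) 0 with h | h
        · rw [min_eq_left h]
          linarith [abs_nonneg (g a + llr ν μ a)]
        · rw [min_eq_right h, abs_of_nonneg h, abs_of_nonneg (by linarith)]
          simp only [abs_zero]
          linarith
      refine ⟨hl, (hsum.sub hl).congr (Filter.Eventually.of_forall fun a => ?_)⟩
      simp
    rw [hL, top_add, eq_comm, ENNReal.add_eq_top]
    rw [not_and_or] at hgi
    refine hgi.imp (fun h => klDiv_of_not_integrable h) fun h => ?_
    by_contra h'
    exact h ((lintegral_ofReal_ne_top_iff_integrable hg.aestronglyMeasurable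
      (Filter.Eventually.of_forall hg0)).1 h')

/-- Gibbs variational identity for an exponential tilt by a nonnegative function. -/
theorem klDiv_tilted_add_lintegral {μ ν : Measure α} [IsProbabilityMeasure μ]
    [IsProbabilityMeasure ν] {g : α → ℝ} (hg : Measurable g) (hg0 : ∀ a, 0 ≤ g a)
    (hi : Integrable (fun a => Real.exp (g a)) μ) :
    klDiv ν (μ.tilted g) + ∫⁻ a, ENNReal.ofReal (g a) ∂ν
      = klDiv ν μ + ENNReal.ofReal (Real.log (∫ a, Real.exp (g a) ∂μ)) := by
  have hprob := isProbabilityMeasure_tilted hi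
  -- Tilting `μ.tilted g` by `-g` gives `μ` back, so the previous identity applies with the roles of
  -- the two measures exchanged.
  have h := klDiv_tilted_neg_add (μ := μ.tilted g) (ν := ν) hg hg0
  have h1 : (μ.tilted g).tilted (fun a => -g a) = μ := tilted_neg_same hi
  have h2 : ∫ a, Real.exp (-g a) ∂(μ.tilted g) = (∫ a, Real.exp (g a) ∂μ)⁻¹ := by
    have := integral_exp_tilted (μ := μ) g (fun a => -g a)
    rw [this]
    simp
  rw [h1, h2, Real.log_inv, neg_neg] at h
  exact h.symm

/-- No integrability is needed: a divergent exponential moment has Bochner integral `0`, and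
`Real.log 0 = 0`. Nonnegativity of the recursion therefore does not wait for the moment assumption.
-/
theorem entropicRisk_nonneg {μ : Measure α} [IsProbabilityMeasure μ] {lam : ℝ} {f : α → ℝ}
    (hf0 : ∀ a, 0 ≤ f a) : 0 ≤ entropicRisk lam μ f := by
  unfold entropicRisk
  rcases le_or_gt lam 0 with hl | hl
  · refine mul_nonneg (by simpa using hl) ?_
    by_cases hi : Integrable (fun a => Real.exp (-lam * f a)) μ
    · refine Real.log_nonneg ?_
      calc (1 : ℝ) = ∫ _, (1 : ℝ) ∂μ := by simp
        _ ≤ _ := integral_mono (integrable_const _) hi fun a => by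
          simpa using mul_nonpos_of_nonpos_of_nonneg hl (hf0 a)
    · rw [integral_undef hi, Real.log_zero]
  · refine mul_nonneg_of_nonpos_of_nonpos (by simpa using hl.le) ?_
    have := integral_exp_neg_le_one (μ := μ) (g := fun a => lam * f a)
      fun a => mul_nonneg hl.le (hf0 a)
    refine Real.log_nonpos (integral_nonneg fun a => (Real.exp_pos _).le) ?_
    simpa using this

theorem integrable_exp_of_pos {μ : Measure α} [IsFiniteMeasure μ] {lam : ℝ} (hl : 0 < lam)
    {f : α → ℝ} (hf : Measurable f) (hf0 : ∀ a, 0 ≤ f a) :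
    Integrable (fun a => Real.exp (-lam * f a)) μ := by
  simpa using integrable_exp_neg (μ := μ) (hf.const_mul lam) fun a => mul_nonneg hl.le (hf0 a)

theorem exp_neg_mul_entropicRisk {μ : Measure α} [IsProbabilityMeasure μ] {lam : ℝ}
    (hl : lam ≠ 0) {f : α → ℝ} (hi : Integrable (fun a => Real.exp (-lam * f a)) μ) :
    Real.exp (-lam * entropicRisk lam μ f) = ∫ a, Real.exp (-lam * f a) ∂μ := by
  unfold entropicRisk
  rw [← mul_assoc, show -lam * -(1 / lam) = 1 by field_simp, one_mul,
    Real.exp_log (integral_exp_pos hi)]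

/-- The constant factor cancels in the normalization. This is why the running cost can be dropped
when optimizing over the next-state law. -/
theorem tilted_const_add {μ : Measure α} {lam : ℝ} {f : α → ℝ} (c : ℝ) :
    μ.tilted (fun a => -lam * (c + f a)) = μ.tilted (fun a => -lam * f a) := by
  unfold Measure.tilted
  congr 1
  funext a
  simp only [mul_add, Real.exp_add]
  rw [integral_const_mul, mul_div_mul_left _ _ (Real.exp_pos _).ne']

/-- The signs of `-λ` inside and `-1/λ` outside compensate each other. -/
theorem entropicRisk_mono {μ : Measure α} [IsProbabilityMeasure μ] {lam : ℝ} {f g : α → ℝ}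
    (hf : Integrable (fun a => Real.exp (-lam * f a)) μ)
    (hg : Integrable (fun a => Real.exp (-lam * g a)) μ) (hfg : ∀ a, f a ≤ g a) :
    entropicRisk lam μ f ≤ entropicRisk lam μ g := by
  unfold entropicRisk
  rcases le_or_gt lam 0 with hl | hl
  · refine mul_le_mul_of_nonneg_left (Real.log_le_log (integral_exp_pos hf)
      (integral_mono hf hg fun a => ?_)) (by simpa using hl)
    exact Real.exp_le_exp.2 (mul_le_mul_of_nonneg_left (hfg a) (by linarith))
  · refine mul_le_mul_of_nonpos_left (Real.log_le_log (integral_exp_pos hg)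
      (integral_mono hg hf fun a => ?_)) (by simpa using hl.le)
    exact Real.exp_le_exp.2 (mul_le_mul_of_nonpos_left (hfg a) (by linarith))

theorem tendsto_entropicRisk {μ : Measure α} [IsProbabilityMeasure μ] {lam : ℝ}
    {f : ℕ → α → ℝ} {g : α → ℝ} (hf : ∀ m, Measurable (f m)) {bound : α → ℝ}
    (hbound : Integrable bound μ) (hfb : ∀ m a, Real.exp (-lam * f m a) ≤ bound a)
    (hg : Integrable (fun a => Real.exp (-lam * g a)) μ)
    (h : ∀ a, Filter.Tendsto (fun m => f m a) Filter.atTop (nhds (g a))) :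
    Filter.Tendsto (fun m => entropicRisk lam μ (f m)) Filter.atTop
      (nhds (entropicRisk lam μ g)) := by
  unfold entropicRisk
  refine Filter.Tendsto.const_mul _ (Filter.Tendsto.log ?_ (integral_exp_pos hg).ne')
  refine tendsto_integral_of_dominated_convergence bound
    (fun m => ?_) hbound (fun m => Filter.Eventually.of_forall fun a => ?_)
    (Filter.Eventually.of_forall fun a => ?_)
  · have := hf m
    exact Measurable.aestronglyMeasurable (by fun_prop)
  · rw [Real.norm_eq_abs, abs_of_pos (Real.exp_pos _)]
    exact hfb m a
  · exact ((h a).const_mul _).rexp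

/-- The one-stage identity behind the minimization over `ν` when `λ > 0`. -/
theorem lintegral_add_klDiv_eq_of_pos {μ ν : Measure α} [IsProbabilityMeasure μ]
    [IsProbabilityMeasure ν] {lam : ℝ} (hl : 0 < lam) {f : α → ℝ} (hf : Measurable f)
    (hf0 : ∀ a, 0 ≤ f a) :
    ∫⁻ a, ENNReal.ofReal (f a) ∂ν + ENNReal.ofReal (1 / lam) * klDiv ν μ
      = ENNReal.ofReal (entropicRisk lam μ f)
        + ENNReal.ofReal (1 / lam) * klDiv ν (μ.tilted fun a => -lam * f a) := by
  have h := congrArg (fun y => ENNReal.ofReal (1 / lam) * y)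
    (klDiv_tilted_neg_add (μ := μ) (ν := ν) (hf.const_mul lam) fun a => mul_nonneg hl.le (hf0 a))
  simp only [mul_add, neg_mul_eq_neg_mul] at h
  rw [← ENNReal.ofReal_mul (by positivity), ← lintegral_const_mul _ (by fun_prop)] at h
  simp only [← ENNReal.ofReal_mul (show 0 ≤ 1 / lam by positivity), ← mul_assoc,
    one_div_mul_cancel hl.ne', one_mul] at h
  rw [add_comm, ← h, add_comm]
  unfold entropicRisk
  simp only [mul_neg, neg_mul]

/-- The one-stage identity behind the maximization over `ν` when `λ < 0`. -/
theorem lintegral_add_klDiv_eq_of_neg {μ ν : Measure α} [IsProbabilityMeasure μ]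
    [IsProbabilityMeasure ν] {lam : ℝ} (hl : lam < 0) {f : α → ℝ} (hf : Measurable f)
    (hf0 : ∀ a, 0 ≤ f a) (hi : Integrable (fun a => Real.exp (-lam * f a)) μ) :
    ∫⁻ a, ENNReal.ofReal (f a) ∂ν
        + ENNReal.ofReal (-(1 / lam)) * klDiv ν (μ.tilted fun a => -lam * f a)
      = ENNReal.ofReal (entropicRisk lam μ f) + ENNReal.ofReal (-(1 / lam)) * klDiv ν μ := by
  have hpos : 0 ≤ -(1 / lam) := by
    rw [neg_nonneg]; exact (one_div_neg.2 hl).le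
  have h := congrArg (fun y => ENNReal.ofReal (-(1 / lam)) * y)
    (klDiv_tilted_add_lintegral (μ := μ) (ν := ν) (hf.const_mul (-lam))
      (fun a => mul_nonneg (by linarith) (hf0 a)) hi)
  simp only [mul_add] at h
  rw [← ENNReal.ofReal_mul hpos, ← lintegral_const_mul _ (by fun_prop)] at h
  simp only [← ENNReal.ofReal_mul hpos, ← mul_assoc] at h
  have h1 : -(1 / lam) * -lam = 1 := by have := hl.ne; field_simp
  simp only [h1, one_mul] at h
  rw [add_comm, h, add_comm]
  rfl

theorem isProbabilityMeasure_tilted_mul {μ : Measure α} [IsProbabilityMeasure μ] {lam : ℝ}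
    {f : α → ℝ} (hi : Integrable (fun a => Real.exp (-lam * f a)) μ) :
    IsProbabilityMeasure (μ.tilted fun a => -lam * f a) :=
  isProbabilityMeasure_tilted hi

/-- At the tilt itself the leftover divergence vanishes, so the weighted penalty plus a nonnegative
risk equals the tilted mean of `f`. Bounded costs thus have tilts of finite penalty, which is what
truncation exploits. -/
theorem klDiv_tilted_le_of_le_const {μ : Measure α} [IsProbabilityMeasure μ] {lam : ℝ}
    (hl : lam < 0) {f : α → ℝ} (hf : Measurable f) (hf0 : ∀ a, 0 ≤ f a) {C : ℝ}
    (hfC : ∀ a, f a ≤ C) :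
    ENNReal.ofReal (-(1 / lam)) * klDiv (μ.tilted fun a => -lam * f a) μ ≤ ENNReal.ofReal C := by
  have hi : Integrable (fun a => Real.exp (-lam * f a)) μ := by
    refine Integrable.of_bound (C := Real.exp (-lam * C))
      (Measurable.aestronglyMeasurable (by fun_prop)) (Filter.Eventually.of_forall fun a => ?_)
    rw [Real.norm_eq_abs, abs_of_pos (Real.exp_pos _)]
    exact Real.exp_le_exp.2 (mul_le_mul_of_nonneg_left (hfC a) (by linarith))
  have := isProbabilityMeasure_tilted_mul hi
  have h := lintegral_add_klDiv_eq_of_neg (ν := μ.tilted fun a => -lam * f a) hl hf hf0 hi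
  rw [klDiv_self, mul_zero, add_zero] at h
  calc _ ≤ _ := le_add_self
    _ = _ := h.symm
    _ ≤ ∫⁻ _, ENNReal.ofReal C ∂(μ.tilted fun a => -lam * f a) :=
      lintegral_mono fun a => ENNReal.ofReal_le_ofReal (hfC a)
    _ = _ := by rw [lintegral_const, measure_univ, mul_one]

theorem tilted_eq_withDensity_entropicRisk {μ : Measure α} [IsProbabilityMeasure μ] {lam : ℝ}
    (hl : lam ≠ 0) {f : α → ℝ} (hi : Integrable (fun a => Real.exp (-lam * f a)) μ) :
    μ.tilted (fun a => -lam * f a) = μ.withDensity fun a =>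
      ENNReal.ofReal (Real.exp (-lam * f a) / Real.exp (-lam * entropicRisk lam μ f)) := by
  rw [exp_neg_mul_entropicRisk hl hi]
  rfl

end GibbsVariational

/-! ### Measurable dependence of risk and divergence on a kernel's parameter -/

section Kernels

variable {α β : Type*} [MeasurableSpace α] [MeasurableSpace β]

theorem measurable_entropicRisk {κ : Kernel α β} [IsSFiniteKernel κ] {f : α × β → ℝ}
    (hf : Measurable f) (lam : ℝ) :
    Measurable fun a => entropicRisk lam (κ a) fun b => f (a, b) := by
  unfold entropicRisk
  have : Measurable fun a => ∫ b, Real.exp (-lam * f (a, b)) ∂κ a :=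
    (StronglyMeasurable.integral_kernel_prod_right' (f := fun p => Real.exp (-lam * f p))
      (Measurable.stronglyMeasurable (by fun_prop))).measurable
  fun_prop

theorem withDensity_entropicRisk_apply {κ : Kernel α β} [IsMarkovKernel κ] {f : α × β → ℝ}
    (hf : Measurable f) {lam : ℝ} (hl : lam ≠ 0) {a : α}
    (hi : Integrable (fun b => Real.exp (-lam * f (a, b))) (κ a)) :
    κ.withDensity (fun a b => ENNReal.ofReal (Real.exp (-lam * f (a, b))
      / Real.exp (-lam * entropicRisk lam (κ a) fun b => f (a, b)))) a
      = (κ a).tilted fun b => -lam * f (a, b) := by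
  have := measurable_entropicRisk (κ := κ) hf lam
  have h : Measurable fun p : α × β => ENNReal.ofReal (Real.exp (-lam * f p)
      / Real.exp (-lam * entropicRisk lam (κ p.1) fun b => f (p.1, b))) := by
    have h1 : Measurable fun p : α × β => entropicRisk lam (κ p.1) fun b => f (p.1, b) :=
      this.comp measurable_fst
    fun_prop
  rw [Kernel.withDensity_apply _ h,
    tilted_eq_withDensity_entropicRisk hl hi]

open Classical in
theorem measurable_klDiv_kernel [MeasurableSpace.CountableOrCountablyGenerated α β]
    (κ η : Kernel α β) [IsFiniteKernel κ] [IsFiniteKernel η] :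
    Measurable fun a => klDiv (κ a) (η a) := by
  have h : (fun a => klDiv (κ a) (η a)) = fun a => if κ a ≪ η a then
      ∫⁻ b, ENNReal.ofReal (klFun (Kernel.rnDeriv κ η a b).toReal) ∂(η a) else ∞ := by
    -- The jointly measurable kernel density agrees almost everywhere, for each parameter, with the
    -- Radon–Nikodym derivative of the fibre measures; countable generation provides it.
    funext a
    rw [klDiv_eq_lintegral_klFun]
    congr 1
    refine lintegral_congr_ae ?_
    filter_upwards [Kernel.rnDeriv_eq_rnDeriv_measure (κ := κ) (η := η) (a := a)] with b hb
    rw [hb]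
  rw [h]
  refine Measurable.ite (Kernel.measurableSet_absolutelyContinuous κ η) ?_ measurable_const
  have h1 := Kernel.measurable_rnDeriv κ η
  refine Measurable.lintegral_kernel_prod_right ?_
  have h2 : Measurable fun p : α × β => Kernel.rnDeriv κ η p.1 p.2 := h1
  exact (measurable_klFun.comp h2.ennreal_toReal).ennreal_ofReal

end Kernels

/-! ### Signed penalties in the extended reals -/

section ERealPenalty

theorem coe_add_mul_coe_of_nonneg {r : ℝ} (hr : 0 ≤ r) (A K : ℝ≥0∞) :
    (A : EReal) + (r : EReal) * (K : EReal) = ((A + ENNReal.ofReal r * K : ℝ≥0∞) : EReal) := by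
  rw [EReal.coe_ennreal_add, EReal.coe_ennreal_mul, EReal.coe_ennreal_ofReal, max_eq_left hr]

theorem coe_mul_coe_of_neg {r : ℝ} (hr : r < 0) (K : ℝ≥0∞) :
    (r : EReal) * (K : EReal) = -((ENNReal.ofReal (-r) * K : ℝ≥0∞) : EReal) := by
  rw [EReal.coe_ennreal_mul, EReal.coe_ennreal_ofReal, max_eq_left (by linarith), EReal.coe_neg,
    EReal.neg_mul, neg_neg]

/-- Finiteness of `K` is essential: for `A = K = ⊤` the right side holds, while the sum on the left
is `⊥`. -/
theorem coe_le_coe_add_neg_mul_iff {r : ℝ} (hr : r < 0) {A B K : ℝ≥0∞} (hK : K ≠ ⊤) :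
    (B : EReal) ≤ (A : EReal) + (r : EReal) * (K : EReal) ↔ B + ENNReal.ofReal (-r) * K ≤ A := by
  have hW : ENNReal.ofReal (-r) * K ≠ ⊤ := ENNReal.mul_ne_top ENNReal.ofReal_ne_top hK
  rw [coe_mul_coe_of_neg hr K, ← sub_eq_add_neg,
    EReal.le_sub_iff_add_le (Or.inl (EReal.coe_ennreal_ne_bot _))
      (Or.inl (mt EReal.coe_ennreal_eq_top_iff.1 hW)),
    ← EReal.coe_ennreal_add, EReal.coe_ennreal_le_coe_ennreal_iff]

/-- In this direction an infinite penalty is harmless, since it makes the left side `⊥`. -/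
theorem coe_add_neg_mul_le {r : ℝ} (hr : r < 0) {A B K : ℝ≥0∞}
    (h : A ≤ B + ENNReal.ofReal (-r) * K) :
    (A : EReal) + (r : EReal) * (K : EReal) ≤ (B : EReal) := by
  by_cases hK : K = ⊤
  · rw [hK, EReal.coe_ennreal_top, EReal.coe_mul_top_of_neg hr]
    simp
  have hW : ENNReal.ofReal (-r) * K ≠ ⊤ := ENNReal.mul_ne_top ENNReal.ofReal_ne_top hK
  rw [coe_mul_coe_of_neg hr K, ← sub_eq_add_neg,
    EReal.sub_le_iff_le_add (Or.inl (EReal.coe_ennreal_ne_bot _))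
      (Or.inl (mt EReal.coe_ennreal_eq_top_iff.1 hW)),
    ← EReal.coe_ennreal_add, EReal.coe_ennreal_le_coe_ennreal_iff]
  exact h

theorem coe_ennreal_ofReal_of_nonneg {x : ℝ} (hx : 0 ≤ x) :
    ((ENNReal.ofReal x : ℝ≥0∞) : EReal) = (x : EReal) := by
  rw [EReal.coe_ennreal_ofReal, max_eq_left hx]

/-- A bound in the extended reals for a sequence of extended nonnegative reals passes to its
limit inferior. -/
theorem coe_liminf_le {A : ℕ → ℝ≥0∞} {b : EReal} (h : ∀ m, ((A m : ℝ≥0∞) : EReal) ≤ b) :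
    ((Filter.liminf A Filter.atTop : ℝ≥0∞) : EReal) ≤ b := by
  have hb : 0 ≤ b := (EReal.coe_ennreal_nonneg _).trans (h 0)
  rw [← EReal.coe_toENNReal hb] at h ⊢
  simp only [EReal.coe_ennreal_le_coe_ennreal_iff] at h ⊢
  exact Filter.liminf_le_of_le (by isBoundedDefault) fun c hc =>
    (hc.exists).elim fun m hm => hm.trans (h m)

end ERealPenalty

/-! ### The one-stage optimization problem -/

section Stage

variable {α : Type*} [MeasurableSpace α] {μ ν : Measure α} {lam : ℝ} {f : α → ℝ}

theorem klStage_of_pos (hl : 0 < lam) :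
    klStage lam μ f ν
      = ((∫⁻ a, ENNReal.ofReal (f a) ∂ν + ENNReal.ofReal (1 / lam) * klDiv ν μ : ℝ≥0∞) : EReal) :=
  coe_add_mul_coe_of_nonneg (one_div_pos.2 hl).le _ _

variable [IsProbabilityMeasure μ]

theorem entropicRisk_bounds_klStage (hl : lam ≠ 0) (hf : Measurable f) (hf0 : ∀ a, 0 ≤ f a)
    (hi : Integrable (fun a => Real.exp (-lam * f a)) μ) [IsProbabilityMeasure ν] :
    if 0 < lam then (entropicRisk lam μ f : EReal) ≤ klStage lam μ f ν
      else klStage lam μ f ν ≤ (entropicRisk lam μ f : EReal) := by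
  rw [← coe_ennreal_ofReal_of_nonneg (entropicRisk_nonneg hf0)]
  split_ifs with h
  · rw [klStage_of_pos h, EReal.coe_ennreal_le_coe_ennreal_iff,
      lintegral_add_klDiv_eq_of_pos h hf hf0]
    exact le_self_add
  · have hl' : lam < 0 := lt_of_le_of_ne (not_lt.1 h) hl
    refine coe_add_neg_mul_le (one_div_neg.2 hl') ?_
    rw [← lintegral_add_klDiv_eq_of_neg hl' hf hf0 hi]
    exact le_self_add

/-- Attaining the risk forces the leftover divergence to the tilt to be zero, once the finite terms
of the Gibbs identity are cancelled. -/
theorem eq_tilted_of_klStage_eq (hl : lam ≠ 0) (hf : Measurable f) (hf0 : ∀ a, 0 ≤ f a)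
    (hi : Integrable (fun a => Real.exp (-lam * f a)) μ) [IsProbabilityMeasure ν]
    (h : klStage lam μ f ν = (entropicRisk lam μ f : EReal)) :
    ν = μ.tilted fun a => -lam * f a := by
  have hprob := isProbabilityMeasure_tilted_mul hi
  rw [← coe_ennreal_ofReal_of_nonneg (entropicRisk_nonneg hf0)] at h
  rw [← klDiv_eq_zero_iff]
  rcases lt_or_gt_of_ne hl with hl' | hl'
  · have hr := one_div_neg.2 hl'
    have hw : ENNReal.ofReal (-(1 / lam)) ≠ 0 := by simpa using hr
    -- An infinite penalty would give the value `⊥`. Finiteness of the penalty then bounds the mean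
    -- of `f` through the identity, which permits cancellation.
    have hK : klDiv ν μ ≠ ⊤ := by
      intro hK
      rw [klStage, hK, EReal.coe_ennreal_top, EReal.coe_mul_top_of_neg hr] at h
      simp only [EReal.add_bot] at h
      exact absurd h.symm (EReal.coe_ennreal_ne_bot _)
    have h1 := (coe_le_coe_add_neg_mul_iff hr hK).1 h.ge
    have h2 := lintegral_add_klDiv_eq_of_neg (ν := ν) hl' hf hf0 hi
    have hA : ∫⁻ a, ENNReal.ofReal (f a) ∂ν ≠ ⊤ := by
      refine ne_top_of_le_ne_top ?_ (le_self_add.trans_eq h2)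
      exact ENNReal.add_ne_top.2 ⟨ENNReal.ofReal_ne_top, ENNReal.mul_ne_top ENNReal.ofReal_ne_top hK⟩
    rw [← h2] at h1
    have h3 : ENNReal.ofReal (-(1 / lam)) * klDiv ν (μ.tilted fun a => -lam * f a) ≤ 0 := by
      refine (ENNReal.add_le_add_iff_left hA).1 ?_
      simpa using h1
    exact (mul_eq_zero.1 (nonpos_iff_eq_zero.1 h3)).resolve_left hw
  · rw [klStage_of_pos hl', EReal.coe_ennreal_eq_coe_ennreal_iff,
      lintegral_add_klDiv_eq_of_pos hl' hf hf0] at h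
    have h3 : ENNReal.ofReal (1 / lam) * klDiv ν (μ.tilted fun a => -lam * f a) = 0 := by
      refine (ENNReal.add_right_inj (a := ENNReal.ofReal (entropicRisk lam μ f))
        ENNReal.ofReal_ne_top).1 ?_
      simpa using h
    refine (mul_eq_zero.1 h3).resolve_left ?_
    simpa using hl'

theorem klStage_tilted (hl : lam ≠ 0) (hf : Measurable f) (hf0 : ∀ a, 0 ≤ f a)
    (hi : Integrable (fun a => Real.exp (-lam * f a)) μ)
    (hK : lam < 0 → klDiv (μ.tilted fun a => -lam * f a) μ ≠ ⊤) :
    klStage lam μ f (μ.tilted fun a => -lam * f a) = (entropicRisk lam μ f : EReal) := by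
  have hprob := isProbabilityMeasure_tilted_mul hi
  rcases lt_or_gt_of_ne hl with hl' | hl'
  · have hb := entropicRisk_bounds_klStage (ν := μ.tilted fun a => -lam * f a) hl hf hf0 hi
    rw [if_neg hl'.not_gt] at hb
    refine le_antisymm hb ?_
    rw [← coe_ennreal_ofReal_of_nonneg (entropicRisk_nonneg hf0)]
    refine (coe_le_coe_add_neg_mul_iff (one_div_neg.2 hl') (hK hl')).2 ?_
    rw [← lintegral_add_klDiv_eq_of_neg hl' hf hf0 hi, klDiv_self]
    simp
  · rw [klStage_of_pos hl', lintegral_add_klDiv_eq_of_pos hl' hf hf0, klDiv_self,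
      ← coe_ennreal_ofReal_of_nonneg (entropicRisk_nonneg hf0)]
    simp

theorem isArgOpt_klStage_iff (hl : lam ≠ 0) (hf : Measurable f) (hf0 : ∀ a, 0 ≤ f a)
    (hi : Integrable (fun a => Real.exp (-lam * f a)) μ)
    (hK : lam < 0 → klDiv (μ.tilted fun a => -lam * f a) μ ≠ ⊤) (ν : Measure α) :
    IsArgOpt lam (probMeasures α) (klStage lam μ f) ν ↔ ν = μ.tilted fun a => -lam * f a := by
  have hprob := isProbabilityMeasure_tilted_mul hi
  have hval := klStage_tilted hl hf hf0 hi hK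
  constructor
  · rintro ⟨hν, hopt⟩
    have : IsProbabilityMeasure ν := hν
    refine eq_tilted_of_klStage_eq hl hf hf0 hi ?_
    have h1 := hopt _ hprob
    have h2 := entropicRisk_bounds_klStage (ν := ν) hl hf hf0 hi
    rw [hval] at h1
    split_ifs at h1 h2 with h
    · exact le_antisymm h1 h2
    · exact le_antisymm h2 h1
  · rintro rfl
    refine ⟨hprob, fun ν' hν' => ?_⟩
    have : IsProbabilityMeasure ν' := hν'
    rw [hval]
    exact entropicRisk_bounds_klStage hl hf hf0 hi

theorem integrable_exp_min {μ : Measure α} [IsFiniteMeasure μ] (lam : ℝ) (hf : Measurable f)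
    (hf0 : ∀ a, 0 ≤ f a) (m : ℕ) :
    Integrable (fun a => Real.exp (-lam * min (f a) m)) μ := by
  refine Integrable.of_bound (C := Real.exp (|lam| * m))
    (Measurable.aestronglyMeasurable (by fun_prop)) (Filter.Eventually.of_forall fun a => ?_)
  rw [Real.norm_eq_abs, abs_of_pos (Real.exp_pos _)]
  refine Real.exp_le_exp.2 ?_
  have h0 : 0 ≤ min (f a) (m : ℝ) := le_min (hf0 a) (Nat.cast_nonneg m)
  calc -lam * min (f a) m ≤ |lam| * min (f a) m :=
        mul_le_mul_of_nonneg_right (neg_le_abs lam) h0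
    _ ≤ _ := mul_le_mul_of_nonneg_left (min_le_right _ _) (abs_nonneg _)

theorem tendsto_min_natCast {x : ℕ → ℝ} {y : ℝ}
    (h : Filter.Tendsto x Filter.atTop (nhds y)) :
    Filter.Tendsto (fun m => min (x m) (m : ℝ)) Filter.atTop (nhds y) := by
  refine h.congr' ?_
  filter_upwards [h.eventually_lt_const (lt_add_one y),
    (tendsto_natCast_atTop_atTop (R := ℝ)).eventually_ge_atTop (y + 1)] with m h1 h2
  exact (min_eq_left (by linarith)).symm

/-- For `λ < 0` the tilt may have infinite divergence and fail to attain the supremum. The tilts of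
the truncations `min f m` have finite divergence, and their values, which increase when `f` replaces
`min f m`, approach the risk. -/
theorem optOver_klStage (hl : lam ≠ 0) (hf : Measurable f) (hf0 : ∀ a, 0 ≤ f a)
    (hi : Integrable (fun a => Real.exp (-lam * f a)) μ) :
    optOver lam (probMeasures α) (klStage lam μ f) = (entropicRisk lam μ f : EReal) := by
  unfold optOver
  rcases lt_or_gt_of_ne hl with hl' | hl'
  · rw [if_neg hl'.not_gt]
    apply le_antisymm
    · refine iSup₂_le fun ν hν => ?_
      have : IsProbabilityMeasure ν := hν
      have := entropicRisk_bounds_klStage (ν := ν) hl hf hf0 hi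
      rwa [if_neg hl'.not_gt] at this
    · have hlim : Filter.Tendsto (fun m : ℕ => entropicRisk lam μ fun a => min (f a) (m : ℝ))
          Filter.atTop (nhds (entropicRisk lam μ f)) :=
        tendsto_entropicRisk (fun m => by fun_prop) hi
          (fun m a => Real.exp_le_exp.2
            (mul_le_mul_of_nonneg_left (min_le_left _ _) (by linarith))) hi
          fun a => tendsto_min_natCast tendsto_const_nhds
      refine le_of_tendsto ((continuous_coe_real_ereal.tendsto _).comp hlim)
        (Filter.Eventually.of_forall fun m => ?_)
      have hfm : Measurable fun a => min (f a) (m : ℝ) := by fun_prop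
      have hfm0 : ∀ a, 0 ≤ min (f a) (m : ℝ) := fun a => le_min (hf0 a) (Nat.cast_nonneg m)
      have him := integrable_exp_min (μ := μ) lam hf hf0 m
      have hprob := isProbabilityMeasure_tilted_mul him
      have hK : klDiv (μ.tilted fun a => -lam * min (f a) (m : ℝ)) μ ≠ ⊤ := by
        intro hK
        have := klDiv_tilted_le_of_le_const (μ := μ) hl' hfm hfm0 fun a => min_le_right _ _
        rw [hK, ENNReal.mul_top (by simpa using hl'), top_le_iff] at this
        exact ENNReal.ofReal_ne_top this
      have h1 := klStage_tilted hl hfm hfm0 him fun _ => hK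
      simp only [Function.comp_apply]
      rw [← h1]
      refine le_trans ?_ (le_iSup₂_of_le (μ.tilted fun a => -lam * min (f a) (m : ℝ)) hprob le_rfl)
      unfold klStage
      exact add_le_add (EReal.coe_ennreal_le_coe_ennreal_iff.2 (lintegral_mono fun a =>
        ENNReal.ofReal_le_ofReal (min_le_left _ _))) le_rfl
  · rw [if_pos hl']
    have hprob := isProbabilityMeasure_tilted_mul hi
    apply le_antisymm
    · refine (iInf₂_le_of_le (μ.tilted fun a => -lam * f a) hprob le_rfl).trans ?_
      exact (klStage_tilted hl hf hf0 hi fun h => absurd h hl'.not_gt).le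
    · refine le_iInf₂ fun ν hν => ?_
      have : IsProbabilityMeasure ν := hν
      have := entropicRisk_bounds_klStage (ν := ν) hl hf hf0 hi
      rwa [if_pos hl'] at this

end Stage

/-! ### Additive functionals of trajectories and the comparison principle -/

section Trajectories

variable {X U : Type*}

/-- Additive functional of a trajectory that starts at time `t`: running terms `r` plus a terminal
term `rT`. -/
def runningSum (r : ℕ → X × U → ℝ≥0∞) (rT : X → ℝ≥0∞) (n t : ℕ) (ξ : Trajectory X U n) : ℝ≥0∞ :=
  (∑ k : Fin n, r (t + k) (ξ.1 k.castSucc, ξ.2 k)) + rT (ξ.1 (Fin.last _))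

theorem runningSum_cons (r : ℕ → X × U → ℝ≥0∞) (rT : X → ℝ≥0∞) (n t : ℕ) (x : X) (u : U)
    (ξ : Trajectory X U n) :
    runningSum r rT (n + 1) t (Trajectory.cons (x, u, ξ))
      = r t (x, u) + runningSum r rT n (t + 1) ξ := by
  unfold runningSum Trajectory.cons
  rw [Fin.sum_univ_succ, add_assoc]
  simp only [Fin.val_zero, add_zero, Fin.castSucc_zero, Fin.cons_zero, Fin.val_succ,
    ← Fin.succ_castSucc, Fin.cons_succ, ← Fin.succ_last]
  congr 2
  exact Finset.sum_congr rfl fun k _ => by rw [add_right_comm, add_assoc]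

variable [MeasurableSpace X] [MeasurableSpace U]

theorem measurable_runningSum {r : ℕ → X × U → ℝ≥0∞} {rT : X → ℝ≥0∞} {n t : ℕ}
    (hr : ∀ k, t ≤ k → k < t + n → Measurable (r k)) (hrT : Measurable rT) :
    Measurable (runningSum r rT n t) := by
  unfold runningSum
  refine Measurable.add (Finset.measurable_sum _ fun k _ => ?_) (by fun_prop)
  exact (hr _ (by omega) (by omega)).comp (by fun_prop)

/-- Only times in the window `[t, t + n)` are constrained, since admissible sequences are arbitrary
from the horizon on. -/
theorem isMarkovKernel_trajKernel {π : ℕ → Kernel X U} {τ : ℕ → Kernel (X × U) X} (n : ℕ) :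
    ∀ t, (∀ k, t ≤ k → k < t + n → IsMarkovKernel (π k)) →
      (∀ k, t ≤ k → k < t + n → IsMarkovKernel (τ k)) → IsMarkovKernel (trajKernel π τ n t) := by
  induction n with
  | zero => intro t _ _; unfold trajKernel; infer_instance
  | succ n ih =>
    intro t hπ hτ
    have := hπ t le_rfl (by omega)
    have := hτ t le_rfl (by omega)
    have := ih (t + 1) (fun k _ _ => hπ k (by omega) (by omega))
      fun k _ _ => hτ k (by omega) (by omega)
    unfold trajKernel
    exact Kernel.IsMarkovKernel.map _ Trajectory.measurable_cons

theorem lintegral_trajKernel_zero (π : ℕ → Kernel X U) (τ : ℕ → Kernel (X × U) X)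
    (r : ℕ → X × U → ℝ≥0∞) {rT : X → ℝ≥0∞} (hrT : Measurable rT) (t : ℕ) (x : X) :
    ∫⁻ ξ, runningSum r rT 0 t ξ ∂(trajKernel π τ 0 t x) = rT x := by
  unfold trajKernel
  rw [Kernel.lintegral_deterministic' _
    (measurable_runningSum (fun k _ _ => by omega) hrT)]
  simp [runningSum]

theorem lintegral_trajKernel_succ {π : ℕ → Kernel X U} {τ : ℕ → Kernel (X × U) X}
    {r : ℕ → X × U → ℝ≥0∞} {rT : X → ℝ≥0∞} {n t : ℕ}
    (hπ : ∀ k, t ≤ k → k < t + (n + 1) → IsMarkovKernel (π k))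
    (hτ : ∀ k, t ≤ k → k < t + (n + 1) → IsMarkovKernel (τ k))
    (hr : ∀ k, t ≤ k → k < t + (n + 1) → Measurable (r k)) (hrT : Measurable rT) (x : X) :
    ∫⁻ ξ, runningSum r rT (n + 1) t ξ ∂(trajKernel π τ (n + 1) t x)
      = ∫⁻ u, (r t (x, u) + ∫⁻ x', ∫⁻ ξ, runningSum r rT n (t + 1) ξ
          ∂(trajKernel π τ n (t + 1) x') ∂(τ t (x, u))) ∂(π t x) := by
  have h1 := hπ t le_rfl (by omega)
  have h2 := hτ t le_rfl (by omega)
  have h3 := isMarkovKernel_trajKernel (π := π) (τ := τ) n (t + 1)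
    (fun k _ _ => hπ k (by omega) (by omega)) fun k _ _ => hτ k (by omega) (by omega)
  have hS := measurable_runningSum (n := n + 1) (t := t) hr hrT
  have hS' : Measurable (runningSum r rT n (t + 1)) :=
    measurable_runningSum (fun k _ _ => hr k (by omega) (by omega)) hrT
  have hrt := hr t le_rfl (by omega)
  have hc : Measurable fun p : X × U × Trajectory X U n =>
      runningSum r rT (n + 1) t (Trajectory.cons p) := hS.comp Trajectory.measurable_cons
  rw [trajKernel, Kernel.lintegral_map _ Trajectory.measurable_cons _ hS,
    Kernel.lintegral_id_prod hc]
  have hsplit (p : U × Trajectory X U n) : runningSum r rT (n + 1) t (Trajectory.cons (x, p))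
      = r t (x, p.1) + runningSum r rT n (t + 1) p.2 := runningSum_cons r rT n t x p.1 p.2
  simp only [hsplit]
  rw [Kernel.lintegral_compProd _ _ _ (by fun_prop)]
  refine lintegral_congr fun u => ?_
  rw [lintegral_add_left (by fun_prop), Kernel.lintegral_comp _ _ _ hS']
  simp

variable {π : ℕ → Kernel X U} {τ : ℕ → Kernel (X × U) X}
  {r s : ℕ → X × U → ℝ≥0∞} {rT : X → ℝ≥0∞} {a : ℕ → X → ℝ≥0∞}

theorem measurable_lintegral_trajKernel {n t : ℕ}
    (hr : ∀ k, t ≤ k → k < t + n → Measurable (r k)) (hrT : Measurable rT) :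
    Measurable fun x => ∫⁻ ξ, runningSum r rT n t ξ ∂(trajKernel π τ n t x) :=
  (measurable_runningSum hr hrT).lintegral_kernel

theorem lintegral_step_add {κ : Kernel X U} {η : Kernel (X × U) X} [IsMarkovKernel κ]
    [IsMarkovKernel η] {r : X × U → ℝ≥0∞} {a b : X → ℝ≥0∞} (hr : Measurable r)
    (ha : Measurable a) (hb : Measurable b) (x : X) :
    ∫⁻ u, (r (x, u) + ∫⁻ x', (a x' + b x') ∂(η (x, u))) ∂(κ x)
      = ∫⁻ u, (r (x, u) + ∫⁻ x', a x' ∂(η (x, u))) ∂(κ x)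
        + ∫⁻ u, ∫⁻ x', b x' ∂(η (x, u)) ∂(κ x) := by
  have h1 : Measurable fun z => ∫⁻ x', a x' ∂(η z) := ha.lintegral_kernel
  have h2 : Measurable fun z => ∫⁻ x', b x' ∂(η z) := hb.lintegral_kernel
  simp only [lintegral_add_left ha, ← add_assoc]
  rw [lintegral_add_left (by fun_prop)]

/-- Comparison principle: a backward supersolution bounds the expected additive functional. -/
theorem lintegral_runningSum_le (n : ℕ) : ∀ t,
    (∀ k, t ≤ k → k < t + n → IsMarkovKernel (π k)) →
    (∀ k, t ≤ k → k < t + n → IsMarkovKernel (τ k)) →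
    (∀ k, t ≤ k → k < t + n → Measurable (r k)) →
    (∀ k, t ≤ k → k < t + n → Measurable (s k)) → Measurable rT →
    (∀ k, t ≤ k → k ≤ t + n → Measurable (a k)) →
    (∀ k, t ≤ k → k < t + n → ∀ x,
      ∫⁻ u, (r k (x, u) + ∫⁻ x', a (k + 1) x' ∂(τ k (x, u))) ∂(π k x)
        ≤ a k x + ∫⁻ u, s k (x, u) ∂(π k x)) →
    (∀ x, rT x ≤ a (t + n) x) → ∀ x,
    ∫⁻ ξ, runningSum r rT n t ξ ∂(trajKernel π τ n t x)
      ≤ a t x + ∫⁻ ξ, runningSum s 0 n t ξ ∂(trajKernel π τ n t x) := by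
  induction n with
  | zero =>
    intro t _ _ _ _ hrT _ _ hT x
    rw [lintegral_trajKernel_zero _ _ _ hrT]
    exact (hT x).trans le_self_add
  | succ n ih =>
    intro t hπ hτ hr hs hrT ha hstep hT x
    have h1 := hπ t le_rfl (by omega)
    have h2 := hτ t le_rfl (by omega)
    have hst := hs t le_rfl (by omega)
    rw [lintegral_trajKernel_succ hπ hτ hr hrT,
      lintegral_trajKernel_succ hπ hτ hs measurable_zero]
    have hle := ih (t + 1) (fun k _ _ => hπ k (by omega) (by omega))
      (fun k _ _ => hτ k (by omega) (by omega)) (fun k _ _ => hr k (by omega) (by omega))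
      (fun k _ _ => hs k (by omega) (by omega)) hrT (fun k _ _ => ha k (by omega) (by omega))
      (fun k _ _ => hstep k (by omega) (by omega))
      (by rwa [show t + 1 + n = t + (n + 1) by omega])
    have hb : Measurable fun x => ∫⁻ ξ, runningSum s 0 n (t + 1) ξ
        ∂(trajKernel π τ n (t + 1) x) :=
      measurable_lintegral_trajKernel (fun k _ _ => hs k (by omega) (by omega)) measurable_zero
    -- Bound the future by induction, split off its penalty part, and apply the one-step inequality
    -- to what remains. Only sums occur, so infinite values cause no trouble.
    calc _ ≤ _ := lintegral_mono fun u => add_le_add le_rfl (lintegral_mono hle)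
      _ = _ := lintegral_step_add (hr t le_rfl (by omega)) (ha (t + 1) (by omega) (by omega)) hb x
      _ ≤ _ := add_le_add (hstep t le_rfl (by omega) x) le_rfl
      _ = _ := by rw [add_assoc, ← lintegral_add_left (by fun_prop)]

/-- Comparison principle: a backward subsolution is bounded by the expected additive functional. -/
theorem le_lintegral_runningSum (n : ℕ) : ∀ t,
    (∀ k, t ≤ k → k < t + n → IsMarkovKernel (π k)) →
    (∀ k, t ≤ k → k < t + n → IsMarkovKernel (τ k)) →
    (∀ k, t ≤ k → k < t + n → Measurable (r k)) →
    (∀ k, t ≤ k → k < t + n → Measurable (s k)) → Measurable rT →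
    (∀ k, t ≤ k → k ≤ t + n → Measurable (a k)) →
    (∀ k, t ≤ k → k < t + n → ∀ x,
      a k x + ∫⁻ u, s k (x, u) ∂(π k x)
        ≤ ∫⁻ u, (r k (x, u) + ∫⁻ x', a (k + 1) x' ∂(τ k (x, u))) ∂(π k x)) →
    (∀ x, a (t + n) x ≤ rT x) → ∀ x,
    a t x + ∫⁻ ξ, runningSum s 0 n t ξ ∂(trajKernel π τ n t x)
      ≤ ∫⁻ ξ, runningSum r rT n t ξ ∂(trajKernel π τ n t x) := by
  induction n with
  | zero =>
    intro t _ _ _ _ hrT _ _ hT x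
    rw [lintegral_trajKernel_zero _ _ _ hrT, lintegral_trajKernel_zero _ _ _ measurable_zero]
    simpa using hT x
  | succ n ih =>
    intro t hπ hτ hr hs hrT ha hstep hT x
    have h1 := hπ t le_rfl (by omega)
    have h2 := hτ t le_rfl (by omega)
    have hst := hs t le_rfl (by omega)
    rw [lintegral_trajKernel_succ hπ hτ hr hrT,
      lintegral_trajKernel_succ hπ hτ hs measurable_zero]
    have hle := ih (t + 1) (fun k _ _ => hπ k (by omega) (by omega))
      (fun k _ _ => hτ k (by omega) (by omega)) (fun k _ _ => hr k (by omega) (by omega))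
      (fun k _ _ => hs k (by omega) (by omega)) hrT (fun k _ _ => ha k (by omega) (by omega))
      (fun k _ _ => hstep k (by omega) (by omega))
      (by rwa [show t + 1 + n = t + (n + 1) by omega])
    have hb : Measurable fun x => ∫⁻ ξ, runningSum s 0 n (t + 1) ξ
        ∂(trajKernel π τ n (t + 1) x) :=
      measurable_lintegral_trajKernel (fun k _ _ => hs k (by omega) (by omega)) measurable_zero
    calc _ = _ := by rw [lintegral_add_left (by fun_prop), ← add_assoc]
      _ ≤ _ := add_le_add (hstep t le_rfl (by omega) x) le_rfl
      _ = _ := (lintegral_step_add (hr t le_rfl (by omega))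
        (ha (t + 1) (by omega) (by omega)) hb x).symm
      _ ≤ _ := lintegral_mono fun u => add_le_add le_rfl (lintegral_mono hle)

end Trajectories

/-! ### The recursion with a transformed continuation cost -/

namespace KLControl

variable {X U : Type*} [MeasurableSpace X] [MeasurableSpace U] (P : KLControl X U)

/-- The backward recursion with the continuation cost transformed by `φ`; `φ = id` gives the value
functions and `φ = min · m` a truncated recursion. -/
def valueRec (φ : ℝ → ℝ) : ℕ → ℕ → X → ℝ
  | 0, _, x => P.cT x
  | n + 1, t, x =>
    entropicRisk P.lamP (P.ρ t x) fun u =>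
      entropicRisk P.lamS (P.ι t (x, u)) fun x' => φ (P.c t (x, u) + valueRec φ n (t + 1) x')

/-- The state value function of the recursion transformed by `φ`. -/
def VRec (φ : ℝ → ℝ) (t : ℕ) (x : X) : ℝ := P.valueRec φ (P.T - t) t x

/-- The state-action value function of the recursion transformed by `φ`. -/
def QRec (φ : ℝ → ℝ) (t : ℕ) (z : X × U) : ℝ :=
  entropicRisk P.lamS (P.ι t z) fun x' => φ (P.c t z + P.VRec φ (t + 1) x')

/-- The transition kernels tilted by the transformed continuation cost. -/
def tiltedTransition (φ : ℝ → ℝ) (t : ℕ) : Kernel (X × U) X :=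
  (P.ι t).withDensity fun z x' =>
    ENNReal.ofReal (Real.exp (-P.lamS * φ (P.c t z + P.VRec φ (t + 1) x'))
      / Real.exp (-P.lamS * P.QRec φ t z))

theorem valueRec_id (n : ℕ) : ∀ t, P.valueRec id n t = P.valueAux n t := by
  induction n with
  | zero => intro t; rfl
  | succ n ih =>
    intro t
    funext x
    simp only [valueRec, valueAux, ih, id]

theorem VRec_id : P.VRec id = P.V := by
  funext t x
  unfold VRec V
  rw [valueRec_id]

theorem QRec_id : P.QRec id = P.Q := by
  funext t z
  unfold QRec Q
  rw [VRec_id]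
  rfl

theorem tiltedTransition_id : P.tiltedTransition id = P.optTransition := by
  funext t
  unfold tiltedTransition optTransition
  rw [VRec_id, QRec_id]
  rfl

theorem VRec_T (φ : ℝ → ℝ) (x : X) : P.VRec φ P.T x = P.cT x := by
  unfold VRec
  rw [Nat.sub_self]
  rfl

theorem VRec_of_lt (φ : ℝ → ℝ) {t : ℕ} (ht : t < P.T) (x : X) :
    P.VRec φ t x = entropicRisk P.lamP (P.ρ t x) fun u => P.QRec φ t (x, u) := by
  unfold VRec QRec VRec
  rw [show P.T - t = P.T - (t + 1) + 1 by omega]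
  rfl

section Recursion

variable {φ : ℝ → ℝ}

theorem measurable_valueRec (hφ : Measurable φ) (n : ℕ) : ∀ t, Measurable (P.valueRec φ n t) := by
  induction n with
  | zero => intro t; exact P.cT_measurable
  | succ n ih =>
    intro t
    have h1 := P.c_measurable t
    have h2 := ih (t + 1)
    have h3 : Measurable fun z : X × U => entropicRisk P.lamS (P.ι t z)
        fun x' => φ (P.c t z + P.valueRec φ n (t + 1) x') :=
      measurable_entropicRisk
        (f := fun p : (X × U) × X => φ (P.c t p.1 + P.valueRec φ n (t + 1) p.2)) (by fun_prop) _
    exact measurable_entropicRisk h3 _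

theorem measurable_VRec (hφ : Measurable φ) (t : ℕ) : Measurable (P.VRec φ t) :=
  P.measurable_valueRec hφ _ _

theorem measurable_continuation (hφ : Measurable φ) (t : ℕ) :
    Measurable fun p : (X × U) × X => φ (P.c t p.1 + P.VRec φ (t + 1) p.2) := by
  have h1 := P.c_measurable t
  have h2 := P.measurable_VRec hφ (t + 1)
  fun_prop

theorem measurable_QRec (hφ : Measurable φ) (t : ℕ) : Measurable (P.QRec φ t) :=
  measurable_entropicRisk (P.measurable_continuation hφ t) _

theorem valueRec_nonneg (hφ0 : ∀ y, 0 ≤ y → 0 ≤ φ y) (n : ℕ) :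
    ∀ t x, 0 ≤ P.valueRec φ n t x := by
  induction n with
  | zero => intro t x; exact P.cT_nonneg x
  | succ n ih =>
    intro t x
    exact entropicRisk_nonneg fun u => entropicRisk_nonneg fun x' =>
      hφ0 _ (add_nonneg (P.c_nonneg _ _) (ih _ _))

theorem VRec_nonneg (hφ0 : ∀ y, 0 ≤ y → 0 ≤ φ y) (t : ℕ) (x : X) : 0 ≤ P.VRec φ t x :=
  P.valueRec_nonneg hφ0 _ _ _

theorem continuation_nonneg (hφ0 : ∀ y, 0 ≤ y → 0 ≤ φ y) (t : ℕ) (z : X × U) (x' : X) :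
    0 ≤ φ (P.c t z + P.VRec φ (t + 1) x') :=
  hφ0 _ (add_nonneg (P.c_nonneg _ _) (P.VRec_nonneg hφ0 _ _))

theorem QRec_nonneg (hφ0 : ∀ y, 0 ≤ y → 0 ≤ φ y) (t : ℕ) (z : X × U) : 0 ≤ P.QRec φ t z :=
  entropicRisk_nonneg fun x' => P.continuation_nonneg hφ0 t z x'

theorem tiltedTransition_apply (hφ : Measurable φ) {t : ℕ} {z : X × U}
    (hi : Integrable (fun x' => Real.exp (-P.lamS * φ (P.c t z + P.VRec φ (t + 1) x')))
      (P.ι t z)) :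
    P.tiltedTransition φ t z
      = (P.ι t z).tilted fun x' => -P.lamS * φ (P.c t z + P.VRec φ (t + 1) x') :=
  withDensity_entropicRisk_apply (P.measurable_continuation hφ t) P.lamS_ne_zero hi

end Recursion

theorem measurable_V (t : ℕ) : Measurable (P.V t) := by
  rw [← VRec_id]
  exact P.measurable_VRec measurable_id t

theorem measurable_Q (t : ℕ) : Measurable (P.Q t) := by
  rw [← QRec_id]
  exact P.measurable_QRec measurable_id t

theorem V_nonneg (t : ℕ) (x : X) : 0 ≤ P.V t x := by
  rw [← VRec_id]
  exact P.VRec_nonneg (fun _ h => h) t x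

theorem Q_nonneg (t : ℕ) (z : X × U) : 0 ≤ P.Q t z := by
  rw [← QRec_id]
  exact P.QRec_nonneg (fun _ h => h) t z

theorem V_of_lt {t : ℕ} (ht : t < P.T) (x : X) :
    P.V t x = entropicRisk P.lamP (P.ρ t x) fun u => P.Q t (x, u) := by
  rw [← VRec_id, ← QRec_id]
  exact P.VRec_of_lt id ht x

theorem integrable_exp_Q (t : ℕ) (x : X) :
    Integrable (fun u => Real.exp (-P.lamP * P.Q t (x, u))) (P.ρ t x) :=
  integrable_exp_of_pos P.lamP_pos ((P.measurable_Q t).comp measurable_prodMk_left)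
    fun u => P.Q_nonneg t (x, u)

theorem optPolicy_apply {t : ℕ} (ht : t < P.T) (x : X) :
    P.optPolicy t x = (P.ρ t x).tilted fun u => -P.lamP * P.Q t (x, u) := by
  rw [← withDensity_entropicRisk_apply (P.measurable_Q t) P.lamP_pos.ne' (P.integrable_exp_Q t x)]
  unfold optPolicy
  simp only [P.V_of_lt ht]

theorem optPolicy_mem_policies : P.optPolicy ∈ P.policies := fun t ht => ⟨fun x => by
  rw [P.optPolicy_apply ht]
  exact isProbabilityMeasure_tilted_mul (P.integrable_exp_Q t x)⟩

theorem tiltedTransition_mem_transitions {φ : ℝ → ℝ} (hφ : Measurable φ)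
    (hi : ∀ t < P.T, ∀ z : X × U, Integrable
      (fun x' => Real.exp (-P.lamS * φ (P.c t z + P.VRec φ (t + 1) x'))) (P.ι t z)) :
    P.tiltedTransition φ ∈ P.transitions := fun t ht => ⟨fun z => by
  rw [P.tiltedTransition_apply hφ (hi t ht z)]
  exact isProbabilityMeasure_tilted_mul (hi t ht z)⟩

/-! ### The objective as an additive functional -/

section Objective

variable {π : ℕ → Kernel X U} {τ : ℕ → Kernel (X × U) X}

theorem cumCost_eq_runningSum (t : ℕ) :
    P.cumCost t = runningSum (fun k z => ENNReal.ofReal (P.c k z))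
      (fun x => ENNReal.ofReal (P.cT x)) (P.T - t) t := rfl

theorem policyKL_eq_runningSum (t : ℕ) :
    P.policyKL π t = runningSum (fun k z => klDiv (π k z.1) (P.ρ k z.1)) 0 (P.T - t) t := by
  funext ξ
  simp [policyKL, runningSum]

theorem transitionKL_eq_runningSum (t : ℕ) :
    P.transitionKL τ t = runningSum (fun k z => klDiv (τ k z) (P.ι k z)) 0 (P.T - t) t := by
  funext ξ
  simp [transitionKL, runningSum]

theorem measurable_cumCost (t : ℕ) : Measurable (P.cumCost t) := by
  rw [cumCost_eq_runningSum]
  exact measurable_runningSum (fun k _ _ => (P.c_measurable k).ennreal_ofReal)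
    P.cT_measurable.ennreal_ofReal

theorem lintegral_law (t : ℕ) (μ : Measure X) {F : Trajectory X U (P.T - t) → ℝ≥0∞}
    (hF : Measurable F) :
    ∫⁻ ξ, F ξ ∂(P.law π τ t μ) = ∫⁻ x, ∫⁻ ξ, F ξ ∂(trajKernel π τ (P.T - t) t x) ∂μ :=
  Measure.lintegral_bind (Kernel.aemeasurable _) hF.aemeasurable

/-- Expected cost plus weighted policy penalty. -/
def policyCost (t : ℕ) (μ : Measure X) (π : ℕ → Kernel X U) (τ : ℕ → Kernel (X × U) X) : ℝ≥0∞ :=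
  ∫⁻ ξ, P.cumCost t ξ ∂(P.law π τ t μ)
    + ENNReal.ofReal (1 / P.lamP) * ∫⁻ ξ, P.policyKL π t ξ ∂(P.law π τ t μ)

/-- Merging the two nonnegative terms in `ℝ≥0∞` leaves a single signed term to be handled in
`EReal`. -/
theorem objective_eq (t : ℕ) (μ : Measure X) (π : ℕ → Kernel X U) (τ : ℕ → Kernel (X × U) X) :
    P.objective t μ π τ = ((P.policyCost t μ π τ : ℝ≥0∞) : EReal)
      + ((1 / P.lamS : ℝ) : EReal) * ((P.expTransitionKL t μ π τ : ℝ≥0∞) : EReal) := by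
  unfold objective policyCost
  rw [coe_add_mul_coe_of_nonneg (one_div_pos.2 P.lamP_pos).le]

theorem lintegral_stage_eq (hπ : π ∈ P.policies) {α : ℝ≥0∞} {b : X → ℝ≥0∞} {k : ℕ} (hk : k < P.T) (x : X) :
    ∫⁻ u, (ENNReal.ofReal (P.c k (x, u)) + ENNReal.ofReal (1 / P.lamP) * klDiv (π k x) (P.ρ k x)
          + α * klDiv (τ k (x, u)) (P.ι k (x, u)) + ∫⁻ x', b x' ∂(τ k (x, u))) ∂(π k x)
      = ∫⁻ u, (ENNReal.ofReal (P.c k (x, u)) + α * klDiv (τ k (x, u)) (P.ι k (x, u))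
          + ∫⁻ x', b x' ∂(τ k (x, u))) ∂(π k x)
        + ENNReal.ofReal (1 / P.lamP) * klDiv (π k x) (P.ρ k x) := by
  have := hπ k hk
  calc _ = ∫⁻ u, (ENNReal.ofReal (P.c k (x, u)) + α * klDiv (τ k (x, u)) (P.ι k (x, u))
          + ∫⁻ x', b x' ∂(τ k (x, u)) + ENNReal.ofReal (1 / P.lamP) * klDiv (π k x) (P.ρ k x))
          ∂(π k x) := lintegral_congr fun u => by abel
    _ = _ := by rw [lintegral_add_right _ measurable_const, lintegral_const, measure_univ, mul_one]

theorem measurable_klDiv_policy [MeasurableSpace.CountablyGenerated U] (hπ : π ∈ P.policies) {k : ℕ} (hk : k < P.T) :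
    Measurable fun x => klDiv (π k x) (P.ρ k x) := by
  have := hπ k hk
  exact measurable_klDiv_kernel _ _

theorem measurable_klDiv_transition [MeasurableSpace.CountablyGenerated X] (hτ : τ ∈ P.transitions) {k : ℕ} (hk : k < P.T) :
    Measurable fun z => klDiv (τ k z) (P.ι k z) := by
  have := hτ k hk
  exact measurable_klDiv_kernel _ _

theorem measurable_policyKL [MeasurableSpace.CountablyGenerated U] (hπ : π ∈ P.policies) (t : ℕ) : Measurable (P.policyKL π t) := by
  rw [policyKL_eq_runningSum]
  exact measurable_runningSum (fun k _ _ =>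
    (P.measurable_klDiv_policy hπ (by omega)).comp measurable_fst) measurable_zero

theorem measurable_transitionKL [MeasurableSpace.CountablyGenerated X] (hτ : τ ∈ P.transitions)
    (t : ℕ) :
    Measurable (P.transitionKL τ t) := by
  rw [transitionKL_eq_runningSum]
  exact measurable_runningSum (fun k _ _ => P.measurable_klDiv_transition hτ (by omega))
    measurable_zero

theorem mul_expTransitionKL_eq [MeasurableSpace.CountablyGenerated X] (hτ : τ ∈ P.transitions)
    (β : ℝ≥0∞) (t : ℕ) (μ : Measure X) :
    β * P.expTransitionKL t μ π τ
      = ∫⁻ x, ∫⁻ ξ, runningSum (fun k z => β * klDiv (τ k z) (P.ι k z)) 0 (P.T - t) t ξ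
          ∂(trajKernel π τ (P.T - t) t x) ∂μ := by
  have h3 := P.measurable_transitionKL hτ t
  have hsum : ∀ ξ, runningSum (fun k z => β * klDiv (τ k z) (P.ι k z)) 0 (P.T - t) t ξ
      = β * P.transitionKL τ t ξ := by
    intro ξ
    simp [runningSum, transitionKL, Finset.mul_sum]
  simp only [hsum]
  rw [← P.lintegral_law t μ (by fun_prop), lintegral_const_mul _ h3]
  rfl

variable [MeasurableSpace.CountablyGenerated X] [MeasurableSpace.CountablyGenerated U]

/-- Here `α` serves as `1/λ^S` when that is positive and as `0` otherwise. In the negative case the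
penalty goes to the value side, with the weight `β = -1/λ^S` in the comparisons below. -/
theorem policyCost_add_eq (hπ : π ∈ P.policies) (hτ : τ ∈ P.transitions) (α : ℝ≥0∞) (t : ℕ)
    (μ : Measure X) :
    P.policyCost t μ π τ + α * P.expTransitionKL t μ π τ
      = ∫⁻ x, ∫⁻ ξ, runningSum (fun k z => ENNReal.ofReal (P.c k z)
          + ENNReal.ofReal (1 / P.lamP) * klDiv (π k z.1) (P.ρ k z.1)
          + α * klDiv (τ k z) (P.ι k z)) (fun x => ENNReal.ofReal (P.cT x)) (P.T - t) t ξ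
          ∂(trajKernel π τ (P.T - t) t x) ∂μ := by
  have h1 := P.measurable_cumCost t
  have h2 := P.measurable_policyKL hπ t
  have h3 := P.measurable_transitionKL hτ t
  have hsum : ∀ ξ, runningSum (fun k z => ENNReal.ofReal (P.c k z)
          + ENNReal.ofReal (1 / P.lamP) * klDiv (π k z.1) (P.ρ k z.1)
          + α * klDiv (τ k z) (P.ι k z)) (fun x => ENNReal.ofReal (P.cT x)) (P.T - t) t ξ
      = P.cumCost t ξ + ENNReal.ofReal (1 / P.lamP) * P.policyKL π t ξ
        + α * P.transitionKL τ t ξ := by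
    intro ξ
    unfold runningSum cumCost policyKL transitionKL
    simp only [Finset.sum_add_distrib, Finset.mul_sum]
    abel
  simp only [hsum]
  rw [← P.lintegral_law t μ (by fun_prop), lintegral_add_left (by fun_prop),
    lintegral_add_left h1, lintegral_const_mul _ h2, lintegral_const_mul _ h3]
  rfl

variable {a : ℕ → X → ℝ≥0∞} {q : ℕ → X × U → ℝ≥0∞} {α β : ℝ≥0∞}

/-- Backward subsolutions bound the objective from below. -/
theorem lintegral_add_le_policyCost_add (hπ : π ∈ P.policies) (hτ : τ ∈ P.transitions)
    (ha : ∀ k, Measurable (a k)) (hq : ∀ k, Measurable (q k))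
    (h1 : ∀ k < P.T, ∀ z, q k z + β * klDiv (τ k z) (P.ι k z)
      ≤ ENNReal.ofReal (P.c k z) + α * klDiv (τ k z) (P.ι k z) + ∫⁻ x', a (k + 1) x' ∂(τ k z))
    (h2 : ∀ k < P.T, ∀ x, a k x ≤ ∫⁻ u, q k (x, u) ∂(π k x)
      + ENNReal.ofReal (1 / P.lamP) * klDiv (π k x) (P.ρ k x))
    (h3 : ∀ x, a P.T x ≤ ENNReal.ofReal (P.cT x)) {t : ℕ} (ht : t ≤ P.T) (μ : Measure X) :
    ∫⁻ x, a t x ∂μ + β * P.expTransitionKL t μ π τ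
      ≤ P.policyCost t μ π τ + α * P.expTransitionKL t μ π τ := by
  rw [P.policyCost_add_eq hπ hτ, P.mul_expTransitionKL_eq hτ, ← lintegral_add_left (ha t)]
  have hc := P.c_measurable
  refine lintegral_mono fun x => le_lintegral_runningSum (P.T - t) t
    (fun k _ _ => hπ k (by omega)) (fun k _ _ => hτ k (by omega)) (fun k _ _ => ?_)
    (fun k _ _ => ?_) P.cT_measurable.ennreal_ofReal (fun k _ _ => ha k) (fun k _ hk x => ?_)
    (by rwa [show t + (P.T - t) = P.T by omega]) x
  · have : Measurable fun z : X × U => klDiv (π k z.1) (P.ρ k z.1) :=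
      (P.measurable_klDiv_policy hπ (by omega)).comp measurable_fst
    have := P.measurable_klDiv_transition hτ (k := k) (by omega)
    have := hc k
    fun_prop
  · have := P.measurable_klDiv_transition hτ (k := k) (by omega)
    fun_prop
  · have hk' : k < P.T := by omega
    rw [P.lintegral_stage_eq hπ hk']
    have hqk := hq k
    calc _ ≤ _ := add_le_add (h2 k hk' x) le_rfl
      _ = ∫⁻ u, (q k (x, u) + β * klDiv (τ k (x, u)) (P.ι k (x, u))) ∂(π k x)
          + ENNReal.ofReal (1 / P.lamP) * klDiv (π k x) (P.ρ k x) := by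
        rw [lintegral_add_left (by fun_prop), add_right_comm]
      _ ≤ _ := add_le_add (lintegral_mono fun u => h1 k hk' (x, u)) le_rfl

/-- Backward supersolutions bound the objective from above. -/
theorem policyCost_add_le_lintegral_add (hπ : π ∈ P.policies) (hτ : τ ∈ P.transitions)
    (ha : ∀ k, Measurable (a k)) (hq : ∀ k, Measurable (q k))
    (h1 : ∀ k < P.T, ∀ z,
      ENNReal.ofReal (P.c k z) + α * klDiv (τ k z) (P.ι k z) + ∫⁻ x', a (k + 1) x' ∂(τ k z)
        ≤ q k z + β * klDiv (τ k z) (P.ι k z))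
    (h2 : ∀ k < P.T, ∀ x, ∫⁻ u, q k (x, u) ∂(π k x)
      + ENNReal.ofReal (1 / P.lamP) * klDiv (π k x) (P.ρ k x) ≤ a k x)
    (h3 : ∀ x, ENNReal.ofReal (P.cT x) ≤ a P.T x) {t : ℕ} (ht : t ≤ P.T) (μ : Measure X) :
    P.policyCost t μ π τ + α * P.expTransitionKL t μ π τ
      ≤ ∫⁻ x, a t x ∂μ + β * P.expTransitionKL t μ π τ := by
  rw [P.policyCost_add_eq hπ hτ, P.mul_expTransitionKL_eq hτ, ← lintegral_add_left (ha t)]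
  have hc := P.c_measurable
  refine lintegral_mono fun x => lintegral_runningSum_le (P.T - t) t
    (fun k _ _ => hπ k (by omega)) (fun k _ _ => hτ k (by omega)) (fun k _ _ => ?_)
    (fun k _ _ => ?_) P.cT_measurable.ennreal_ofReal (fun k _ _ => ha k) (fun k _ hk x => ?_)
    (by rwa [show t + (P.T - t) = P.T by omega]) x
  · have : Measurable fun z : X × U => klDiv (π k z.1) (P.ρ k z.1) :=
      (P.measurable_klDiv_policy hπ (by omega)).comp measurable_fst
    have := P.measurable_klDiv_transition hτ (k := k) (by omega)
    have := hc k
    fun_prop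
  · have := P.measurable_klDiv_transition hτ (k := k) (by omega)
    fun_prop
  · have hk' : k < P.T := by omega
    rw [P.lintegral_stage_eq hπ hk']
    have hqk := hq k
    calc _ ≤ _ := add_le_add (lintegral_mono fun u => h1 k hk' (x, u)) le_rfl
      _ = ∫⁻ u, q k (x, u) ∂(π k x) + ENNReal.ofReal (1 / P.lamP) * klDiv (π k x) (P.ρ k x)
          + ∫⁻ u, β * klDiv (τ k (x, u)) (P.ι k (x, u)) ∂(π k x) := by
        rw [lintegral_add_left (by fun_prop), add_right_comm]
      _ ≤ _ := add_le_add (h2 k hk' x) le_rfl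

end Objective

end KLControl

/-! ### Truncation of the continuation cost -/

namespace KLControl

variable {X U : Type*} [MeasurableSpace X] [MeasurableSpace U] (P : KLControl X U)
  {π : ℕ → Kernel X U} {τ : ℕ → Kernel (X × U) X}

/-- The exponential moments of the continuation cost, integrated by the transition kernels. -/
def HasExpMoments (φ : ℝ → ℝ) : Prop :=
  ∀ t < P.T, ∀ z : X × U, Integrable
    (fun x' => Real.exp (-P.lamS * φ (P.c t z + P.VRec φ (t + 1) x'))) (P.ι t z)

/-- Truncation of the continuation cost at level `m`. -/
def truncAt (m : ℕ) (y : ℝ) : ℝ := min y m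

theorem measurable_truncAt (m : ℕ) : Measurable (truncAt m) := by
  unfold truncAt; fun_prop

theorem truncAt_nonneg (m : ℕ) (y : ℝ) (hy : 0 ≤ y) : 0 ≤ truncAt m y :=
  le_min hy (Nat.cast_nonneg m)

theorem truncAt_le (m : ℕ) (y : ℝ) : truncAt m y ≤ y := min_le_left _ _

theorem truncAt_le_natCast (m : ℕ) (y : ℝ) : truncAt m y ≤ m := min_le_right _ _

theorem hasExpMoments_truncAt (m : ℕ) : P.HasExpMoments (truncAt m) := fun t _ z =>
  integrable_exp_min P.lamS
    (f := fun x' => P.c t z + P.VRec (truncAt m) (t + 1) x')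
    ((P.measurable_VRec (measurable_truncAt m) (t + 1)).const_add _)
    (fun _ => add_nonneg (P.c_nonneg t z) (P.VRec_nonneg (truncAt_nonneg m) _ _)) m

/-- For `λ^S > 0` the integrand is at most `1`, so only the other sign needs an assumption. -/
theorem hasExpMoments_id (hexp : P.lamS < 0 → ∀ t < P.T, ∀ z : X × U,
    Integrable (fun x' => Real.exp (-P.lamS * (P.c t z + P.V (t + 1) x'))) (P.ι t z)) :
    P.HasExpMoments id := by
  intro t ht z
  rw [VRec_id]
  rcases lt_or_gt_of_ne P.lamS_ne_zero with h | h
  · exact hexp h t ht z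
  · exact integrable_exp_of_pos h ((P.measurable_V (t + 1)).const_add _)
      fun _ => add_nonneg (P.c_nonneg t z) (P.V_nonneg _ _)

/-- The truncated recursion converges to the value functions from below (risk-averse case). -/
theorem VRec_truncAt_le_and_tendsto (hS : P.lamS < 0) (hi : P.HasExpMoments id) (n : ℕ) :
    ∀ t, t + n = P.T → ∀ x, (∀ m, P.VRec (truncAt m) t x ≤ P.V t x) ∧
      Filter.Tendsto (fun m => P.VRec (truncAt m) t x) Filter.atTop (nhds (P.V t x)) := by
  rw [← VRec_id]
  induction n with
  | zero =>
    intro t ht x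
    obtain rfl : t = P.T := by omega
    simp only [VRec_T]
    exact ⟨fun _ => le_rfl, tendsto_const_nhds⟩
  | succ n ih =>
    intro t ht x
    have ht' : t < P.T := by omega
    have hV := ih (t + 1) (by omega)
    have hle : ∀ m z x', truncAt m (P.c t z + P.VRec (truncAt m) (t + 1) x')
        ≤ id (P.c t z + P.VRec id (t + 1) x') := fun m z x' =>
      (truncAt_le _ _).trans (by simpa using (hV x').1 m)
    have hQle : ∀ m z, P.QRec (truncAt m) t z ≤ P.QRec id t z := fun m z =>
      entropicRisk_mono (P.hasExpMoments_truncAt m t ht' z) (hi t ht' z) fun x' => hle m z x'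
    -- The untruncated exponential dominates because `-λ^S > 0` and truncation lowers the cost. The
    -- level `m` and the next value function vary together, hence `tendsto_min_natCast`.
    have hQlim : ∀ z, Filter.Tendsto (fun m => P.QRec (truncAt m) t z) Filter.atTop
        (nhds (P.QRec id t z)) := fun z =>
      tendsto_entropicRisk
        (fun m => (P.measurable_continuation (measurable_truncAt m) t).comp measurable_prodMk_left)
        (hi t ht' z) (fun m x' => Real.exp_le_exp.2
          (mul_le_mul_of_nonneg_left (hle m z x') (by linarith))) (hi t ht' z)
        fun x' => tendsto_min_natCast ((hV x').2.const_add _)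
    have hQi : ∀ φ : ℝ → ℝ, Measurable φ → (∀ y, 0 ≤ y → 0 ≤ φ y) →
        Integrable (fun u => Real.exp (-P.lamP * P.QRec φ t (x, u))) (P.ρ t x) :=
      fun φ hφ hφ0 => integrable_exp_of_pos P.lamP_pos
        ((P.measurable_QRec hφ t).comp measurable_prodMk_left) fun u => P.QRec_nonneg hφ0 t (x, u)
    have hid := hQi id measurable_id fun _ h => h
    simp only [P.VRec_of_lt _ ht']
    refine ⟨fun m => entropicRisk_mono (hQi _ (measurable_truncAt m) (truncAt_nonneg m)) hid
      fun u => hQle m (x, u), ?_⟩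
    refine tendsto_entropicRisk (bound := fun _ => 1)
      (fun m => (P.measurable_QRec (measurable_truncAt m) t).comp measurable_prodMk_left)
      (integrable_const _) (fun m u => ?_) hid fun u => hQlim (x, u)
    rw [Real.exp_le_one_iff]
    have := mul_nonneg P.lamP_pos.le (P.QRec_nonneg (truncAt_nonneg m) t (x, u))
    linarith

/-! ### One-stage inequalities along the recursion -/

section Stages

variable {φ : ℝ → ℝ}

theorem lintegral_ofReal_const_add {c : ℝ} (hc : 0 ≤ c) {ν : Measure X} [IsProbabilityMeasure ν]
    {f : X → ℝ} (hf0 : ∀ x, 0 ≤ f x) :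
    ∫⁻ x, ENNReal.ofReal (c + f x) ∂ν = ENNReal.ofReal c + ∫⁻ x, ENNReal.ofReal (f x) ∂ν := by
  simp only [fun x => ENNReal.ofReal_add hc (hf0 x)]
  rw [lintegral_add_left measurable_const, lintegral_const, measure_univ, mul_one]

theorem VRec_le_stage (hφ : Measurable φ) (hφ0 : ∀ y, 0 ≤ y → 0 ≤ φ y) (hπ : π ∈ P.policies)
    {k : ℕ} (hk : k < P.T) (x : X) :
    ENNReal.ofReal (P.VRec φ k x) ≤ ∫⁻ u, ENNReal.ofReal (P.QRec φ k (x, u)) ∂(π k x)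
      + ENNReal.ofReal (1 / P.lamP) * klDiv (π k x) (P.ρ k x) := by
  have := hπ k hk
  rw [lintegral_add_klDiv_eq_of_pos (f := fun u => P.QRec φ k (x, u)) P.lamP_pos
    ((P.measurable_QRec hφ k).comp measurable_prodMk_left) fun u => P.QRec_nonneg hφ0 k (x, u),
    ← P.VRec_of_lt φ hk]
  exact le_self_add

theorem optPolicy_stage_eq {k : ℕ} (hk : k < P.T) (x : X) :
    ∫⁻ u, ENNReal.ofReal (P.Q k (x, u)) ∂(P.optPolicy k x)
      + ENNReal.ofReal (1 / P.lamP) * klDiv (P.optPolicy k x) (P.ρ k x)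
      = ENNReal.ofReal (P.V k x) := by
  have := P.optPolicy_mem_policies k hk
  rw [lintegral_add_klDiv_eq_of_pos (f := fun u => P.Q k (x, u)) P.lamP_pos
    ((P.measurable_Q k).comp measurable_prodMk_left) fun u => P.Q_nonneg k (x, u),
    ← P.V_of_lt hk, P.optPolicy_apply hk, klDiv_self, mul_zero, add_zero]

/-- At the tilt the Gibbs identity has no leftover, and `φ y ≤ y` lets the true running cost replace
the transformed one. The truncated values are thus a subsolution of the original problem. -/
theorem tiltedTransition_stage_of_neg (hS : P.lamS < 0) (hφ : Measurable φ)
    (hφ0 : ∀ y, 0 ≤ y → 0 ≤ φ y) (hφle : ∀ y, φ y ≤ y) (hi : P.HasExpMoments φ)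
    {k : ℕ} (hk : k < P.T) (z : X × U) :
    ENNReal.ofReal (P.QRec φ k z)
        + ENNReal.ofReal (-(1 / P.lamS)) * klDiv (P.tiltedTransition φ k z) (P.ι k z)
      ≤ ENNReal.ofReal (P.c k z)
        + ∫⁻ x', ENNReal.ofReal (P.VRec φ (k + 1) x') ∂(P.tiltedTransition φ k z) := by
  have := P.tiltedTransition_mem_transitions hφ hi k hk
  have h := lintegral_add_klDiv_eq_of_neg (ν := P.tiltedTransition φ k z)
    (f := fun x' => φ (P.c k z + P.VRec φ (k + 1) x')) hS
    ((P.measurable_continuation hφ k).comp measurable_prodMk_left)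
    (fun x' => P.continuation_nonneg hφ0 k z x') (hi k hk z)
  rw [← P.tiltedTransition_apply hφ (hi k hk z), klDiv_self, mul_zero, add_zero] at h
  refine h.symm.le.trans ?_
  rw [← lintegral_ofReal_const_add (P.c_nonneg k z) fun x' => P.VRec_nonneg hφ0 (k + 1) x']
  exact lintegral_mono fun x' => ENNReal.ofReal_le_ofReal (hφle _)

theorem transition_stage_le_of_neg (hS : P.lamS < 0) (hi : P.HasExpMoments id)
    (hτ : τ ∈ P.transitions) {k : ℕ} (hk : k < P.T) (z : X × U) :
    ENNReal.ofReal (P.c k z) + ∫⁻ x', ENNReal.ofReal (P.V (k + 1) x') ∂(τ k z)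
      ≤ ENNReal.ofReal (P.Q k z) + ENNReal.ofReal (-(1 / P.lamS)) * klDiv (τ k z) (P.ι k z) := by
  have := hτ k hk
  have h := lintegral_add_klDiv_eq_of_neg (ν := τ k z)
    (f := fun x' => id (P.c k z + P.VRec id (k + 1) x')) hS
    ((P.measurable_continuation measurable_id k).comp measurable_prodMk_left)
    (fun x' => P.continuation_nonneg (fun _ h => h) k z x') (hi k hk z)
  rw [← lintegral_ofReal_const_add (P.c_nonneg k z) fun x' => P.V_nonneg (k + 1) x',
    ← QRec_id, ← VRec_id]
  exact le_self_add.trans_eq h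

/-- The leftover divergence is kept because it has two uses: it is discarded for general `τ` and
vanishes for `τ*`. -/
theorem transition_stage_eq_of_pos (hS : 0 < P.lamS) (hτ : τ ∈ P.transitions)
    {k : ℕ} (hk : k < P.T) (z : X × U) :
    ENNReal.ofReal (P.c k z) + ENNReal.ofReal (1 / P.lamS) * klDiv (τ k z) (P.ι k z)
        + ∫⁻ x', ENNReal.ofReal (P.V (k + 1) x') ∂(τ k z)
      = ENNReal.ofReal (P.Q k z)
        + ENNReal.ofReal (1 / P.lamS) * klDiv (τ k z)
          ((P.ι k z).tilted fun x' => -P.lamS * (P.c k z + P.V (k + 1) x')) := by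
  have := hτ k hk
  have h := lintegral_add_klDiv_eq_of_pos (μ := P.ι k z) (ν := τ k z) hS
    ((P.measurable_V (k + 1)).const_add (P.c k z))
    fun x' => add_nonneg (P.c_nonneg k z) (P.V_nonneg (k + 1) x')
  rw [lintegral_ofReal_const_add (P.c_nonneg k z) fun x' => P.V_nonneg (k + 1) x'] at h
  rw [add_right_comm]
  exact h

theorem optTransition_apply (hi : P.HasExpMoments id) {t : ℕ} (ht : t < P.T) (z : X × U) :
    P.optTransition t z
      = (P.ι t z).tilted fun x' => -P.lamS * (P.c t z + P.V (t + 1) x') := by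
  rw [← tiltedTransition_id, P.tiltedTransition_apply measurable_id (hi t ht z), VRec_id]
  rfl

theorem optTransition_mem_transitions (hi : P.HasExpMoments id) :
    P.optTransition ∈ P.transitions := by
  rw [← tiltedTransition_id]
  exact P.tiltedTransition_mem_transitions measurable_id hi

theorem klDiv_tiltedTransition_truncAt_le (hS : P.lamS < 0) (m : ℕ) {k : ℕ} (hk : k < P.T)
    (z : X × U) :
    ENNReal.ofReal (-(1 / P.lamS)) * klDiv (P.tiltedTransition (truncAt m) k z) (P.ι k z) ≤ m := by
  have hφ := measurable_truncAt m
  rw [P.tiltedTransition_apply hφ (P.hasExpMoments_truncAt m k hk z)]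
  refine (klDiv_tilted_le_of_le_const hS
    ((P.measurable_continuation hφ k).comp measurable_prodMk_left)
    (fun x' => P.continuation_nonneg (truncAt_nonneg m) k z x')
    fun x' => truncAt_le_natCast m _).trans_eq (ENNReal.ofReal_natCast m)

theorem isMarkovKernel_trajKernel_of_mem (hπ : π ∈ P.policies) (hτ : τ ∈ P.transitions) (t : ℕ) :
    IsMarkovKernel (trajKernel π τ (P.T - t) t) :=
  isMarkovKernel_trajKernel _ _ (fun k _ _ => hπ k (by omega)) fun k _ _ => hτ k (by omega)

theorem coe_lintegral_dirac_V (t : ℕ) (x : X) :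
    ((∫⁻ y, ENNReal.ofReal (P.V t y) ∂(Measure.dirac x) : ℝ≥0∞) : EReal)
      = ((P.V t x : ℝ) : EReal) := by
  rw [lintegral_dirac' _ (P.measurable_V t).ennreal_ofReal,
    coe_ennreal_ofReal_of_nonneg (P.V_nonneg t x)]

/-- Each of the `T - t` stages contributes at most `m` to the weighted penalty, whatever the policy.
-/
theorem expTransitionKL_truncAt_ne_top [MeasurableSpace.CountablyGenerated X] (hS : P.lamS < 0)
    (hπ : π ∈ P.policies) (m t : ℕ) (μ : Measure X) [IsFiniteMeasure μ] :
    P.expTransitionKL t μ π (P.tiltedTransition (truncAt m)) ≠ ⊤ := by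
  have hτ := P.tiltedTransition_mem_transitions (measurable_truncAt m) (P.hasExpMoments_truncAt m)
  have hw : ENNReal.ofReal (-(1 / P.lamS)) ≠ 0 := by simpa using hS
  have := P.isMarkovKernel_trajKernel_of_mem hπ hτ t
  suffices h : ENNReal.ofReal (-(1 / P.lamS))
      * P.expTransitionKL t μ π (P.tiltedTransition (truncAt m)) ≠ ⊤ by
    intro h'
    rw [h', ENNReal.mul_top hw] at h
    exact h rfl
  rw [P.mul_expTransitionKL_eq hτ]
  have hle : ∀ ξ, runningSum (fun k z => ENNReal.ofReal (-(1 / P.lamS))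
      * klDiv (P.tiltedTransition (truncAt m) k z) (P.ι k z)) 0 (P.T - t) t ξ
      ≤ ((P.T - t : ℕ) * m : ℝ≥0∞) := by
    intro ξ
    unfold runningSum
    simp only [Pi.zero_apply, add_zero]
    refine (Finset.sum_le_card_nsmul _ _ (m : ℝ≥0∞) fun k _ =>
      P.klDiv_tiltedTransition_truncAt_le hS m (by omega) _).trans_eq ?_
    simp
  refine ne_top_of_le_ne_top ?_ (lintegral_mono fun x => lintegral_mono hle)
  simp only [lintegral_const, measure_univ, mul_one]
  exact ENNReal.mul_ne_top (ENNReal.mul_ne_top (ENNReal.natCast_ne_top _)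
    (ENNReal.natCast_ne_top _)) (measure_ne_top _ _)

end Stages

/-! ### Values of the control problem -/

section Values

variable [MeasurableSpace.CountablyGenerated X] [MeasurableSpace.CountablyGenerated U]

/-- Used with truncation for the lower bound on the inner value, and with `φ = id` for attainment by
`τ*`. -/
theorem VRec_add_le_policyCost_of_neg {φ : ℝ → ℝ} (hS : P.lamS < 0) (hφ : Measurable φ)
    (hφ0 : ∀ y, 0 ≤ y → 0 ≤ φ y) (hφle : ∀ y, φ y ≤ y) (hi : P.HasExpMoments φ)
    (hπ : π ∈ P.policies) {t : ℕ} (ht : t ≤ P.T) (μ : Measure X) :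
    ∫⁻ x, ENNReal.ofReal (P.VRec φ t x) ∂μ
        + ENNReal.ofReal (-(1 / P.lamS)) * P.expTransitionKL t μ π (P.tiltedTransition φ)
      ≤ P.policyCost t μ π (P.tiltedTransition φ) := by
  have h := P.lintegral_add_le_policyCost_add (α := 0) (β := ENNReal.ofReal (-(1 / P.lamS)))
    (a := fun k x => ENNReal.ofReal (P.VRec φ k x)) (q := fun k z => ENNReal.ofReal (P.QRec φ k z))
    hπ (P.tiltedTransition_mem_transitions hφ hi)
    (fun k => (P.measurable_VRec hφ k).ennreal_ofReal)
    (fun k => (P.measurable_QRec hφ k).ennreal_ofReal)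
    (fun k hk z => by
      simpa using P.tiltedTransition_stage_of_neg hS hφ hφ0 hφle hi hk z)
    (fun k hk x => P.VRec_le_stage hφ hφ0 hπ hk x) (fun x => by rw [VRec_T]) ht μ
  simpa using h

theorem optPolicy_policyCost_le_of_neg (hS : P.lamS < 0) (hi : P.HasExpMoments id)
    (hτ : τ ∈ P.transitions) {t : ℕ} (ht : t ≤ P.T) (μ : Measure X) :
    P.policyCost t μ P.optPolicy τ ≤ ∫⁻ x, ENNReal.ofReal (P.V t x) ∂μ
      + ENNReal.ofReal (-(1 / P.lamS)) * P.expTransitionKL t μ P.optPolicy τ := by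
  have h := P.policyCost_add_le_lintegral_add (α := 0) (β := ENNReal.ofReal (-(1 / P.lamS)))
    (a := fun k x => ENNReal.ofReal (P.V k x)) (q := fun k z => ENNReal.ofReal (P.Q k z))
    P.optPolicy_mem_policies hτ (fun k => (P.measurable_V k).ennreal_ofReal)
    (fun k => (P.measurable_Q k).ennreal_ofReal)
    (fun k hk z => by simpa using P.transition_stage_le_of_neg hS hi hτ hk z)
    (fun k hk x => (P.optPolicy_stage_eq hk x).le) (fun x => by rw [← VRec_id, VRec_T]) ht μ
  simpa using h

theorem V_le_policyCost_add_of_pos (hS : 0 < P.lamS) (hπ : π ∈ P.policies)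
    (hτ : τ ∈ P.transitions) {t : ℕ} (ht : t ≤ P.T) (μ : Measure X) :
    ∫⁻ x, ENNReal.ofReal (P.V t x) ∂μ ≤ P.policyCost t μ π τ
      + ENNReal.ofReal (1 / P.lamS) * P.expTransitionKL t μ π τ := by
  have h := P.lintegral_add_le_policyCost_add (α := ENNReal.ofReal (1 / P.lamS)) (β := 0)
    (a := fun k x => ENNReal.ofReal (P.V k x)) (q := fun k z => ENNReal.ofReal (P.Q k z))
    hπ hτ (fun k => (P.measurable_V k).ennreal_ofReal)
    (fun k => (P.measurable_Q k).ennreal_ofReal)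
    (fun k hk z => by
      rw [P.transition_stage_eq_of_pos hS hτ hk z, zero_mul, add_zero]
      exact le_self_add)
    (fun k hk x => by
      have := P.VRec_le_stage measurable_id (fun _ h => h) hπ hk x
      rwa [VRec_id, QRec_id] at this)
    (fun x => by rw [← VRec_id, VRec_T]) ht μ
  simpa using h

theorem opt_policyCost_add_le_of_pos (hS : 0 < P.lamS) (hi : P.HasExpMoments id)
    {t : ℕ} (ht : t ≤ P.T) (μ : Measure X) :
    P.policyCost t μ P.optPolicy P.optTransition
      + ENNReal.ofReal (1 / P.lamS) * P.expTransitionKL t μ P.optPolicy P.optTransition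
      ≤ ∫⁻ x, ENNReal.ofReal (P.V t x) ∂μ := by
  have hτ := P.optTransition_mem_transitions hi
  have h := P.policyCost_add_le_lintegral_add (α := ENNReal.ofReal (1 / P.lamS)) (β := 0)
    (a := fun k x => ENNReal.ofReal (P.V k x)) (q := fun k z => ENNReal.ofReal (P.Q k z))
    P.optPolicy_mem_policies hτ (fun k => (P.measurable_V k).ennreal_ofReal)
    (fun k => (P.measurable_Q k).ennreal_ofReal)
    (fun k hk z => by
      have := hτ k hk
      rw [P.transition_stage_eq_of_pos hS hτ hk z, ← P.optTransition_apply hi hk z, klDiv_self]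
      simp)
    (fun k hk x => (P.optPolicy_stage_eq hk x).le) (fun x => by rw [← VRec_id, VRec_T]) ht μ
  simpa using h

theorem objective_opt_eq (hi : P.HasExpMoments id) {t : ℕ} (ht : t ≤ P.T) (μ : Measure X)
    (hK : P.lamS < 0 → P.expTransitionKL t μ P.optPolicy P.optTransition ≠ ⊤) :
    P.objective t μ P.optPolicy P.optTransition
      = ((∫⁻ x, ENNReal.ofReal (P.V t x) ∂μ : ℝ≥0∞) : EReal) := by
  have hτ := P.optTransition_mem_transitions hi
  rw [objective_eq]
  rcases lt_or_gt_of_ne P.lamS_ne_zero with hS | hS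
  · have hr := one_div_neg.2 hS
    refine le_antisymm (coe_add_neg_mul_le hr (P.optPolicy_policyCost_le_of_neg hS hi hτ ht μ))
      ((coe_le_coe_add_neg_mul_iff hr (hK hS)).2 ?_)
    have := P.VRec_add_le_policyCost_of_neg hS measurable_id (fun _ h => h) (fun _ => le_rfl) hi
      P.optPolicy_mem_policies ht μ
    rwa [VRec_id, tiltedTransition_id] at this
  · rw [coe_add_mul_coe_of_nonneg (one_div_pos.2 hS).le, EReal.coe_ennreal_eq_coe_ennreal_iff]
    exact le_antisymm (P.opt_policyCost_add_le_of_pos hS hi ht μ)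
      (P.V_le_policyCost_add_of_pos hS P.optPolicy_mem_policies hτ ht μ)

theorem innerValue_optPolicy_le (hi : P.HasExpMoments id) {t : ℕ} (ht : t ≤ P.T)
    (μ : Measure X) :
    P.innerValue t μ P.optPolicy ≤ ((∫⁻ x, ENNReal.ofReal (P.V t x) ∂μ : ℝ≥0∞) : EReal) := by
  unfold innerValue optOver
  rcases lt_or_gt_of_ne P.lamS_ne_zero with hS | hS
  · rw [if_neg hS.not_gt]
    refine iSup₂_le fun τ hτ => ?_
    refine (P.objective_eq t μ P.optPolicy τ).trans_le ?_
    exact coe_add_neg_mul_le (one_div_neg.2 hS) (P.optPolicy_policyCost_le_of_neg hS hi hτ ht μ)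
  · rw [if_pos hS]
    exact (iInf₂_le _ (P.optTransition_mem_transitions hi)).trans
      (P.objective_opt_eq hi ht μ fun h => absurd h hS.not_gt).le

theorem le_innerValue (hi : P.HasExpMoments id) (hπ : π ∈ P.policies) {t : ℕ} (ht : t ≤ P.T)
    (μ : Measure X) [IsFiniteMeasure μ] :
    ((∫⁻ x, ENNReal.ofReal (P.V t x) ∂μ : ℝ≥0∞) : EReal) ≤ P.innerValue t μ π := by
  unfold innerValue optOver
  rcases lt_or_gt_of_ne P.lamS_ne_zero with hS | hS
  · rw [if_neg hS.not_gt]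
    have hlim : ∀ x, ENNReal.ofReal (P.V t x)
        = Filter.liminf (fun m => ENNReal.ofReal (P.VRec (truncAt m) t x)) Filter.atTop :=
      fun x => (ENNReal.tendsto_ofReal
        (P.VRec_truncAt_le_and_tendsto hS hi (P.T - t) t (by omega) x).2).liminf_eq.symm
    simp only [hlim]
    -- Fatou's lemma needs no integrability, so the bound survives when the mean of `V_t` is
    -- infinite.
    refine (EReal.coe_ennreal_le_coe_ennreal_iff.2 (lintegral_liminf_le fun m =>
      (P.measurable_VRec (measurable_truncAt m) t).ennreal_ofReal)).trans
      (coe_liminf_le fun m => ?_)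
    refine le_iSup₂_of_le (P.tiltedTransition (truncAt m))
      (P.tiltedTransition_mem_transitions (measurable_truncAt m) (P.hasExpMoments_truncAt m)) ?_
    rw [objective_eq, coe_le_coe_add_neg_mul_iff (one_div_neg.2 hS)
      (P.expTransitionKL_truncAt_ne_top hS hπ m t μ)]
    exact P.VRec_add_le_policyCost_of_neg hS (measurable_truncAt m) (truncAt_nonneg m)
      (truncAt_le m) (P.hasExpMoments_truncAt m) hπ ht μ
  · rw [if_pos hS]
    refine le_iInf₂ fun τ hτ => ?_
    refine le_of_le_of_eq ?_ (P.objective_eq t μ π τ).symm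
    rw [coe_add_mul_coe_of_nonneg (one_div_pos.2 hS).le,
      EReal.coe_ennreal_le_coe_ennreal_iff]
    exact P.V_le_policyCost_add_of_pos hS hπ hτ ht μ

theorem innerValue_optPolicy (hi : P.HasExpMoments id) {t : ℕ} (ht : t ≤ P.T)
    (μ : Measure X) [IsFiniteMeasure μ] :
    P.innerValue t μ P.optPolicy = ((∫⁻ x, ENNReal.ofReal (P.V t x) ∂μ : ℝ≥0∞) : EReal) :=
  le_antisymm (P.innerValue_optPolicy_le hi ht μ)
    (P.le_innerValue hi P.optPolicy_mem_policies ht μ)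

theorem optimalValue_eq (hi : P.HasExpMoments id) {t : ℕ} (ht : t ≤ P.T)
    (μ : Measure X) [IsFiniteMeasure μ] :
    P.optimalValue t μ = ((∫⁻ x, ENNReal.ofReal (P.V t x) ∂μ : ℝ≥0∞) : EReal) :=
  le_antisymm ((iInf₂_le _ P.optPolicy_mem_policies).trans (P.innerValue_optPolicy_le hi ht μ))
    (le_iInf₂ fun _ hπ => P.le_innerValue hi hπ ht μ)

end Values

/-! ### Stagewise optimality of the tilted kernels -/

theorem policy_stage_optimality {t : ℕ} (ht : t < P.T) (x : X) :
    P.V t x = entropicRisk P.lamP (P.ρ t x) (fun u => P.Q t (x, u)) ∧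
    IsLeast (klStage P.lamP (P.ρ t x) (fun u => P.Q t (x, u)) '' probMeasures U)
      ((P.V t x : ℝ) : EReal) ∧
    (∀ ν ∈ probMeasures U,
      klStage P.lamP (P.ρ t x) (fun u => P.Q t (x, u)) ν = ((P.V t x : ℝ) : EReal)
        ↔ ν = P.optPolicy t x) ∧
    P.optPolicy t x = (P.ρ t x).withDensity fun u =>
      ENNReal.ofReal (Real.exp (-P.lamP * P.Q t (x, u)) / Real.exp (-P.lamP * P.V t x)) := by
  have hl := P.lamP_pos.ne'
  have hm : Measurable fun u => P.Q t (x, u) := (P.measurable_Q t).comp measurable_prodMk_left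
  have h0 : ∀ u, 0 ≤ P.Q t (x, u) := fun u => P.Q_nonneg t (x, u)
  have hi := P.integrable_exp_Q t x
  have hprob := isProbabilityMeasure_tilted_mul hi
  have hopt := klStage_tilted hl hm h0 hi fun h => absurd h P.lamP_pos.not_gt
  rw [P.optPolicy_apply ht, P.V_of_lt ht]
  refine ⟨rfl, ⟨⟨_, hprob, hopt⟩, ?_⟩, fun ν hν => ⟨fun h => ?_, ?_⟩,
    tilted_eq_withDensity_entropicRisk hl hi⟩
  · rintro _ ⟨ν, hν, rfl⟩
    have : IsProbabilityMeasure ν := hν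
    have := entropicRisk_bounds_klStage (ν := ν) hl hm h0 hi
    rwa [if_pos P.lamP_pos] at this
  · have : IsProbabilityMeasure ν := hν
    exact eq_tilted_of_klStage_eq hl hm h0 hi h
  · rintro rfl
    exact hopt

theorem transition_stage_optimality (hexp : P.HasExpMoments id) {t : ℕ} (ht : t < P.T)
    (z : X × U) :
    P.Q t z = entropicRisk P.lamS (P.ι t z) (fun x' => P.c t z + P.V (t + 1) x') ∧
    optOver P.lamS (probMeasures X)
      (klStage P.lamS (P.ι t z) (fun x' => P.c t z + P.V (t + 1) x'))
        = ((P.Q t z : ℝ) : EReal) ∧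
    (∀ ν ∈ probMeasures X,
      klStage P.lamS (P.ι t z) (fun x' => P.c t z + P.V (t + 1) x') ν
        = ((P.Q t z : ℝ) : EReal) → ν = P.optTransition t z) ∧
    ((P.lamS < 0 → klDiv (P.optTransition t z) (P.ι t z) ≠ ⊤) →
      klStage P.lamS (P.ι t z) (fun x' => P.c t z + P.V (t + 1) x') (P.optTransition t z)
        = ((P.Q t z : ℝ) : EReal) ∧
      ∀ ν, IsArgOpt P.lamS (probMeasures X) (klStage P.lamS (P.ι t z) (P.V (t + 1))) ν
        ↔ ν = P.optTransition t z) ∧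
    P.optTransition t z = (P.ι t z).withDensity fun x' =>
      ENNReal.ofReal
        (Real.exp (-P.lamS * (P.c t z + P.V (t + 1) x')) / Real.exp (-P.lamS * P.Q t z)) := by
  have hl := P.lamS_ne_zero
  have hV := P.measurable_V (t + 1)
  have hm : Measurable fun x' => P.c t z + P.V (t + 1) x' := hV.const_add _
  have h0 : ∀ x', 0 ≤ P.c t z + P.V (t + 1) x' := fun x' =>
    add_nonneg (P.c_nonneg t z) (P.V_nonneg (t + 1) x')
  have hi : Integrable (fun x' => Real.exp (-P.lamS * (P.c t z + P.V (t + 1) x'))) (P.ι t z) := by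
    have := hexp t ht z
    rwa [VRec_id] at this
  have hiV : Integrable (fun x' => Real.exp (-P.lamS * P.V (t + 1) x')) (P.ι t z) := by
    refine (hi.const_mul (Real.exp (P.lamS * P.c t z))).congr
      (Filter.Eventually.of_forall fun x' => ?_)
    simp only [← Real.exp_add]
    congr 1
    ring
  rw [P.optTransition_apply hexp ht]
  refine ⟨rfl, optOver_klStage hl hm h0 hi, fun ν hν h => ?_, fun hK =>
    ⟨klStage_tilted hl hm h0 hi hK, fun ν => ?_⟩, tilted_eq_withDensity_entropicRisk hl hi⟩
  · have : IsProbabilityMeasure ν := hν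
    exact eq_tilted_of_klStage_eq hl hm h0 hi h
  -- The tilts by `c_t + V_{t+1}` and by `V_{t+1}` coincide, so the argopt characterization applies
  -- without the running cost.
  · rw [tilted_const_add] at hK ⊢
    exact isArgOpt_klStage_iff hl hV (fun x' => P.V_nonneg (t + 1) x') hiV hK ν

end KLControl

end

theorem mainTheorem1 {X U : Type*} [MeasurableSpace X] [MeasurableSpace U]
    [MeasurableSpace.CountablyGenerated X] [MeasurableSpace.CountablyGenerated U]
    (P : KLControl X U)
    -- finiteness of the exponential moments in the risk-averse case
    (hexp : P.lamS < 0 → ∀ t < P.T, ∀ z : X × U,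
      Integrable (fun x' => Real.exp (-P.lamS * (P.c t z + P.V (t + 1) x'))) (P.ι t z)) :
    -- regularity of the recursion and admissibility of the tilted kernels
    (∀ t ≤ P.T, Measurable (P.V t) ∧ ∀ x, 0 ≤ P.V t x) ∧
    (∀ t < P.T, Measurable (P.Q t) ∧ ∀ z, 0 ≤ P.Q t z) ∧
    P.optPolicy ∈ P.policies ∧ P.optTransition ∈ P.transitions ∧
    -- terminal condition
    (∀ x, P.V P.T x = P.cT x) ∧
    -- recursion for `V_t` and the optimal policy
    (∀ t < P.T, ∀ x,
      P.V t x = entropicRisk P.lamP (P.ρ t x) (fun u => P.Q t (x, u)) ∧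
      IsLeast (klStage P.lamP (P.ρ t x) (fun u => P.Q t (x, u)) '' probMeasures U)
        ((P.V t x : ℝ) : EReal) ∧
      (∀ ν ∈ probMeasures U,
        klStage P.lamP (P.ρ t x) (fun u => P.Q t (x, u)) ν = ((P.V t x : ℝ) : EReal)
          ↔ ν = P.optPolicy t x) ∧
      P.optPolicy t x = (P.ρ t x).withDensity fun u =>
        ENNReal.ofReal (Real.exp (-P.lamP * P.Q t (x, u)) / Real.exp (-P.lamP * P.V t x))) ∧
    -- recursion for `Q_t` and the optimal transition kernel
    (∀ t < P.T, ∀ z : X × U,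
      P.Q t z = entropicRisk P.lamS (P.ι t z) (fun x' => P.c t z + P.V (t + 1) x') ∧
      optOver P.lamS (probMeasures X)
        (klStage P.lamS (P.ι t z) (fun x' => P.c t z + P.V (t + 1) x'))
          = ((P.Q t z : ℝ) : EReal) ∧
      (∀ ν ∈ probMeasures X,
        klStage P.lamS (P.ι t z) (fun x' => P.c t z + P.V (t + 1) x') ν
          = ((P.Q t z : ℝ) : EReal) → ν = P.optTransition t z) ∧
      ((P.lamS < 0 → klDiv (P.optTransition t z) (P.ι t z) ≠ ⊤) →
        klStage P.lamS (P.ι t z) (fun x' => P.c t z + P.V (t + 1) x') (P.optTransition t z)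
          = ((P.Q t z : ℝ) : EReal) ∧
        ∀ ν, IsArgOpt P.lamS (probMeasures X) (klStage P.lamS (P.ι t z) (P.V (t + 1))) ν
          ↔ ν = P.optTransition t z) ∧
      P.optTransition t z = (P.ι t z).withDensity fun x' =>
        ENNReal.ofReal
          (Real.exp (-P.lamS * (P.c t z + P.V (t + 1) x')) / Real.exp (-P.lamS * P.Q t z))) ∧
    -- `V_t(x)` is the optimal cost-to-go, and the tilted policies and kernels are optimal
    (∀ t ≤ P.T, ∀ x,
      P.optimalValue t (Measure.dirac x) = ((P.V t x : ℝ) : EReal) ∧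
      P.innerValue t (Measure.dirac x) P.optPolicy = ((P.V t x : ℝ) : EReal) ∧
      ((P.lamS < 0 →
          P.expTransitionKL t (Measure.dirac x) P.optPolicy P.optTransition ≠ ⊤) →
        P.objective t (Measure.dirac x) P.optPolicy P.optTransition
          = ((P.V t x : ℝ) : EReal))) ∧
    -- the full problem, started from the initial law
    (P.optimalValue 0 P.init = ((∫⁻ x, ENNReal.ofReal (P.V 0 x) ∂P.init : ℝ≥0∞) : EReal) ∧
      P.innerValue 0 P.init P.optPolicy = P.optimalValue 0 P.init ∧
      ((P.lamS < 0 → P.expTransitionKL 0 P.init P.optPolicy P.optTransition ≠ ⊤) →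
        P.objective 0 P.init P.optPolicy P.optTransition = P.optimalValue 0 P.init)) := by
  have hi := P.hasExpMoments_id hexp
  refine ⟨fun t _ => ⟨P.measurable_V t, P.V_nonneg t⟩, fun t _ => ⟨P.measurable_Q t, P.Q_nonneg t⟩,
    P.optPolicy_mem_policies, P.optTransition_mem_transitions hi,
    fun x => by rw [← KLControl.VRec_id, KLControl.VRec_T],
    fun t ht x => P.policy_stage_optimality ht x,
    fun t ht z => P.transition_stage_optimality hi ht z, fun t ht x => ?_, ?_⟩
  · rw [← P.coe_lintegral_dirac_V]
    exact ⟨P.optimalValue_eq hi ht _, P.innerValue_optPolicy hi ht _,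
      fun hK => P.objective_opt_eq hi ht _ hK⟩
  · rw [P.optimalValue_eq hi (Nat.zero_le _)]
    exact ⟨rfl, P.innerValue_optPolicy hi (Nat.zero_le _) _,
      fun hK => P.objective_opt_eq hi (Nat.zero_le _) _ hK⟩
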